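/- **Setting.** Let $q\ge 1$, $n\ge 0$. Throughout $\|\cdot\|$ is the $\ell_1$ norm on $\mathbb R^q$ and $B_1(0)$ its closed unit ball, $\operatorname{cone}A$ is the convex conic hull ($\operatorname{cone}\emptyset=\{0\}$), $A^+=\{z\mid z^{\mathsf T}a\ge 0\ \forall a\in A\}$, $A_\infty=\{d\mid y+\alpha d\in A\ \forall y\in A,\alpha\ge0\}$, $\operatorname{vert}$ denotes the set of extreme points, and $d_H$ is the Hausdorff distance for $\|\cdot\|$. A nonzero $w\in A$ is an extreme direction of a cone $A$ if it is not a convex combination of elements of $A\setminus\operatorname{cone}\{w\}$. Consider $$\text{(P)}\qquad \text{minimize } \Gamma(x)\ \text{ with respect to }\le_C\ \text{ subject to } x\in\mathcal X,$$ where $\mathcal X\subseteq\mathbb R^n$ is closed and convex with nonempty interior, $C\subseteq\mathbb R^q$ is a closed, pointed, solid, polyhedral convex cone with $\{0\}\neq C\ne\mathbb R^q$, and $\Gamma:\mathcal X\to\mathbb R^q$ is continuous and $C$-convex. Its upper image is $\mathcal P=\operatorname{cl}(\Gamma(\mathcal X)+C)$. Fix $c\in\operatorname{int}C$ with $\|c\|=1$,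 a nonsingular $T\in\mathbb R^{q\times q}$ with last column $c$, finite sets $R$, $R^*$ generating $C$ and $C^+$ with $\|d\|=1$ for $d\in R$ and $c^{\mathsf T}z=1$ for $z\in R^*$, and tolerances $\varepsilon,\delta>0$. **Scalarizations.** (P$_1(w)$): minimize $w^{\mathsf T}\Gamma(x)$ over $x\in\mathcal X$. (P$_2(v,d)$), $d\ne0$: maximize $z$ subject to $x\in\mathcal X$, $z\in\mathbb R$, $v+zd-\Gamma(x)\in C$. (D$_2(v,d)$): minimize $\sup_{x\in\mathcal X}\{-w^{\mathsf T}\Gamma(x)\}+w^{\mathsf T}v$ subject to $w\in C^+$, $w^{\mathsf T}d=-1$. **Geometric dual.** Let $w(t)=((t_1,\dots,t_{q-1},1)T^{-1})^{\mathsf T}$, $D^*(t)=(t_1,\dots,t_{q-1},\inf_{x\in\mathcal X}w(t)^{\mathsf T}\Gamma(x))\in\mathbb R^{q-1}\times[-\infty,\infty]$, $K=\mathbb R_+e^q$. The geometric dual (D) is: maximize $D^*(t)$ with respect to $\le_K$ subject to $w(t)\in C^+$. For a set $\mathcal Y$, (D$'$) is the same problem with the constraint $w(t)\in(\operatorname{cone}\mathcal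 Y)^+$; $\mathcal T'$ is its feasible set and $\mathcal D'=D^*(\mathcal T')-K$ its lower image. **Solution concepts.** A set $\mathcal Y$ is a $\delta$-outer approximation of $\mathcal P_\infty$ if $\mathcal P_\infty\subseteq\operatorname{cone}\mathcal Y$ and $d_H(\mathcal P_\infty\cap B_1(0),\operatorname{cone}\mathcal Y\cap B_1(0))\le\delta$. A pair $(\bar{\mathcal X},\mathcal Y)$ of finite sets is a finite weak $(\varepsilon,\delta)$-solution of (P) if $\bar{\mathcal X}\ne\emptyset$, every $\bar x\in\bar{\mathcal X}$ is a weak minimizer ($\bar x\in\mathcal X$ and $(\Gamma(\bar x)-\operatorname{int}C)\cap\Gamma(\mathcal X)=\emptyset$), $\mathcal Y$ is a $\delta$-outer approximation of $\mathcal P_\infty$, and $\mathcal P\subseteq\operatorname{conv}\Gamma(\bar{\mathcal X})+\operatorname{cone}\mathcal Y-\varepsilon\{c\}$. A pair $(\bar{\mathcal T},\mathcal Y)$ of finite sets is a finite $(\varepsilon,\delta)$-solution of (D) if $\mathcal Y$ is a $\delta$-outer approximation of $\mathcal P_\infty$, $\bar{\mathcal T}\subseteq\mathcal T'$, $D^*(t)$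 is a $K$-maximal element of $D^*(\mathcal T')$ for each $t\in\bar{\mathcal T}$, and $\mathcal D'\subseteq\operatorname{conv}D^*(\bar{\mathcal T})-K+\varepsilon\{e^q\}$. **Initialization algorithm.** Below, "cut with $(x,w)$" means: add $x$ to $\bar{\mathcal X}$, add $T^{\mathsf T}w/(c^{\mathsf T}w)$ to $\bar{\mathcal T}$, and replace $\mathcal P_0$ by $\mathcal P_0\cap\{y\mid w^{\mathsf T}(y-\Gamma(x))\ge0\}$. Start with $\mathcal Y_{In}=R$, $\hat C=\bar{\mathcal X}=\bar{\mathcal T}=\emptyset$, $\mathcal P_0=\mathbb R^q$; choose $x_0\in\mathcal X$ and put $v=\Gamma(x_0)+\sum_{d\in R}d$. For each $z\in R^*$, solve (P$_1(z)$): if it has an optimal solution $x^*$, cut with $(x^*,z)$. If none of these problems is unbounded, set $\mathcal Y_{Out}=R$ and stop. Otherwise, for each $d\in-R$: if (P$_2(v,d)$) is unbounded, add $d$ to $\mathcal Y_{In}$; if $(x,z)$ and $w$ are optimal for (P$_2(v,d)$) and (D$_2(v,d)$), cut with $(x,w)$. Then set $\mathcal Y_{Out}=\operatorname{vert}((\mathcal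 P_0)_\infty\cap B_1(0))\setminus\{0\}$. While $\mathcal Y_{Out}\setminus(\mathcal Y_{In}\cup\hat C)\ne\emptyset$, take an element $d$ of it and $\tilde r\in\mathcal Y_{In}$ nearest to $d$. If $\|d-\tilde r\|\le\delta$, add $d$ to $\hat C$. Otherwise choose $\lambda\in(0,1)$ with $e:=\lambda d+(1-\lambda)\tilde r\neq0$; if (P$_2(v,e)$) is unbounded, add $e/\|e\|$ to $\mathcal Y_{In}$; if $(x,z)$ and $w$ are optimal for (P$_2(v,e)$) and (D$_2(v,e)$), cut with $(x,w)$ and recompute $\mathcal Y_{Out}$ by the same formula. **Dual algorithm.** (1) Run the initialization algorithm and set $\mathcal D_0=\{t\mid w(t)\in(\operatorname{cone}\mathcal Y_{Out})^+\}\cap\bigcap_{x\in\bar{\mathcal X}}\{t\mid w(t)^{\mathsf T}\Gamma(x)-t_q\ge0\}$. (2) If (P$_1(w)$) is unbounded for some extreme direction $w$ of $(\operatorname{cone}\mathcal Y_{Out})^+$, stop. (3) Set $k=0$, $M=\emptyset$. (4) While $M\ne\mathbb R^q$: set $M=\mathbb R^q$; for each vertex $u$ of $\mathcal D_k$ compute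 an optimal solution $x^u$ of (P$_1(w(u))$), add $x^u$ to $\bar{\mathcal X}$ and $T^{\mathsf T}w(u)$ to $\bar{\mathcal T}$, and, if $u_q-w(u)^{\mathsf T}\Gamma(x^u)>\varepsilon$, replace $M$ by $M\cap\{t\mid w(t)^{\mathsf T}\Gamma(x^u)\ge t_q\}$; if then $M\ne\mathbb R^q$, set $\mathcal D_{k+1}=\mathcal D_k\cap M$ and increase $k$ by one. Output $\bar{\mathcal X},\mathcal Y_{Out},\bar{\mathcal T}$. The algorithm terminates (outside Step 2) if the test in Step 2 is passed, every scalar problem to be solved is either found unbounded, where that case is provided for, or has the optimal solutions asked for, and all loops end after finitely many rounds. **Theorem.** Suppose that the dual algorithm terminates outside its Step 2, with any admissible choices made along the way. Then $(\bar{\mathcal T},\mathcal Y_{Out})$ is a finite $(\varepsilon,\delta)$-solution of (D), and, provided that $\mathcal P\neq\mathbb R^q$, $(\bar{\mathcal X},\mathcal Y_{Out})$ is a finite weak $(\varepsilon,\delta)$-solution of (P). -/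

import Mathlib

open Set
open scoped Matrix Pointwise

namespace UnboundedCVOP

noncomputable section

/-! ### Convex-analytic notions in `ℝ^q` -/

/-- The `ℓ₁` norm on `ℝ^q`. -/
def l1norm {q : ℕ} (y : Fin q → ℝ) : ℝ := ∑ i, |y i|

/-- The closed `ℓ₁` unit ball around the origin. -/
def l1Ball (q : ℕ) : Set (Fin q → ℝ) := {y | l1norm y ≤ 1}

/-- The Hausdorff distance with respect to the `ℓ₁` norm. -/
def l1Hausdorff {q : ℕ} (A B : Set (Fin q → ℝ)) : ENNReal :=
  Metric.hausdorffEDist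
    ((fun y => (WithLp.toLp 1 y : PiLp 1 fun _ : Fin q => ℝ)) '' A)
    ((fun y => (WithLp.toLp 1 y : PiLp 1 fun _ : Fin q => ℝ)) '' B)

/-- The convex conic hull, with `cone ∅ = {0}`. -/
def cone {q : ℕ} (Y : Set (Fin q → ℝ)) : Set (Fin q → ℝ) := (PointedCone.hull ℝ Y : Set _)

/-- The positive dual cone. -/
def dualCone {q : ℕ} (A : Set (Fin q → ℝ)) : Set (Fin q → ℝ) := {z | ∀ a ∈ A, 0 ≤ z ⬝ᵥ a}

/-- The recession cone. -/
def recessionCone {q : ℕ} (A : Set (Fin q → ℝ)) : Set (Fin q → ℝ) :=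
  {d | ∀ y ∈ A, ∀ α : ℝ, 0 ≤ α → y + α • d ∈ A}

/-- Polyhedral convex sets: finite intersections of closed halfspaces. -/
def IsPolyhedral {q : ℕ} (A : Set (Fin q → ℝ)) : Prop :=
  ∃ (r : ℕ) (w : Fin r → Fin q → ℝ) (γ : Fin r → ℝ),
    (∀ i, w i ≠ 0) ∧ A = {y | ∀ i, γ i ≤ w i ⬝ᵥ y}

/-- `w` is an extreme direction of the cone `A`: a nonzero element that is not a convex combination
of elements of `A \ cone {w}`. -/
def IsExtremeDirection {q : ℕ} (A : Set (Fin q → ℝ)) (w : Fin q → ℝ) : Prop :=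
  w ∈ A ∧ w ≠ 0 ∧ w ∉ convexHull ℝ (A \ cone {w})

/-- The nonzero vertices of `A_∞ ∩ B₁(0)`. -/
def outerDirections {q : ℕ} (A : Set (Fin q → ℝ)) : Set (Fin q → ℝ) :=
  (recessionCone A ∩ l1Ball q).extremePoints ℝ \ {0}

/-! ### Convex vector optimization problems -/

/-- The data of the problem: minimize `Γ x` with respect to `≤_C` subject to `x ∈ X`.
The image space is `ℝ^q` with `q = m + 1`; only the values of `Γ` on `X` matter. -/
structure CVOP (n m : ℕ) where
  X : Set (Fin n → ℝ)
  Γ : (Fin n → ℝ) → (Fin (m + 1) → ℝ)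
  C : PointedCone ℝ (Fin (m + 1) → ℝ)

namespace CVOP

variable {n m : ℕ}

/-- The standing assumptions on the problem, including polyhedrality of the ordering cone. -/
structure Assumption (P : CVOP n m) : Prop where
  X_closed : IsClosed P.X
  X_convex : Convex ℝ P.X
  X_interior : (interior P.X).Nonempty
  C_closed : IsClosed (P.C : Set (Fin (m + 1) → ℝ))
  C_ne_zero : (P.C : Set (Fin (m + 1) → ℝ)) ≠ {0}
  C_ne_univ : (P.C : Set (Fin (m + 1) → ℝ)) ≠ univ
  C_pointed : ∀ y ∈ P.C, -y ∈ P.C → y = 0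
  C_solid : (interior (P.C : Set (Fin (m + 1) → ℝ))).Nonempty
  C_polyhedral : IsPolyhedral (P.C : Set (Fin (m + 1) → ℝ))
  Γ_continuous : ContinuousOn P.Γ P.X
  Γ_convex : ∀ x ∈ P.X, ∀ y ∈ P.X, ∀ α : ℝ, 0 ≤ α → α ≤ 1 →
    α • P.Γ x + (1 - α) • P.Γ y - P.Γ (α • x + (1 - α) • y) ∈ P.C

/-- The upper image `cl (Γ(X) + C)`. -/
def upperImage (P : CVOP n m) : Set (Fin (m + 1) → ℝ) :=
  closure (P.Γ '' P.X + (P.C : Set (Fin (m + 1) → ℝ)))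

/-- `x` is a weak minimizer: `x ∈ X` and `({Γ x} - int C) ∩ Γ(X) = ∅`. -/
def IsWeakMinimizer (P : CVOP n m) (x : Fin n → ℝ) : Prop :=
  x ∈ P.X ∧
    ({P.Γ x} - interior (P.C : Set (Fin (m + 1) → ℝ))) ∩ P.Γ '' P.X = ∅

/-- `Y` is a `δ`-outer approximation of the recession cone of the upper image. -/
def IsOuterApprox (P : CVOP n m) (δ : ℝ) (Y : Set (Fin (m + 1) → ℝ)) : Prop :=
  recessionCone P.upperImage ⊆ cone Y ∧
    l1Hausdorff (recessionCone P.upperImage ∩ l1Ball (m + 1)) (cone Y ∩ l1Ball (m + 1)) ≤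
      ENNReal.ofReal δ

/-- `(Xbar, Y)` is a finite weak `(ε, δ)`-solution of the problem (with fixed direction `c`). -/
structure IsFiniteWeakSolution (P : CVOP n m) (c : Fin (m + 1) → ℝ) (ε δ : ℝ)
    (Xbar : Set (Fin n → ℝ)) (Y : Set (Fin (m + 1) → ℝ)) : Prop where
  finite_X : Xbar.Finite
  finite_Y : Y.Finite
  nonempty : Xbar.Nonempty
  weak_minimizers : ∀ x ∈ Xbar, P.IsWeakMinimizer x
  outer : P.IsOuterApprox δ Y
  approx : P.upperImage ⊆ convexHull ℝ (P.Γ '' Xbar) + cone Y - {ε • c}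

/-! ### Scalarizations -/

/-- The weighted sum problem `min wᵀ Γ(x)`, `x ∈ X`, is bounded. -/
def P1Bounded (P : CVOP n m) (w : Fin (m + 1) → ℝ) : Prop :=
  BddBelow ((fun x => w ⬝ᵥ P.Γ x) '' P.X)

/-- `x` is an optimal solution of the weighted sum problem. -/
def P1Optimal (P : CVOP n m) (w : Fin (m + 1) → ℝ) (x : Fin n → ℝ) : Prop :=
  x ∈ P.X ∧ ∀ x' ∈ P.X, w ⬝ᵥ P.Γ x ≤ w ⬝ᵥ P.Γ x'

/-- `(x, z)` is feasible for the Pascoletti-Serafini problem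
`max z` s.t. `x ∈ X`, `Γ(x) - v - z d ≤_C 0`. -/
def P2Feasible (P : CVOP n m) (v d : Fin (m + 1) → ℝ) (x : Fin n → ℝ) (z : ℝ) : Prop :=
  x ∈ P.X ∧ v + z • d - P.Γ x ∈ P.C

/-- The Pascoletti-Serafini problem is unbounded. -/
def P2Unbounded (P : CVOP n m) (v d : Fin (m + 1) → ℝ) : Prop :=
  ¬ BddAbove {z : ℝ | ∃ x, P.P2Feasible v d x z}

/-- `(x, z)` is an optimal solution of the Pascoletti-Serafini problem. -/
def P2Optimal (P : CVOP n m) (v d : Fin (m + 1) → ℝ) (x : Fin n → ℝ) (z : ℝ) : Prop :=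
  P.P2Feasible v d x z ∧ ∀ x' z', P.P2Feasible v d x' z' → z' ≤ z

/-- Feasibility for the Lagrangian dual of the Pascoletti-Serafini problem. -/
def D2Feasible (P : CVOP n m) (d w : Fin (m + 1) → ℝ) : Prop :=
  w ⬝ᵥ d = -1 ∧ w ∈ dualCone (P.C : Set (Fin (m + 1) → ℝ))

/-- The objective `sup_{x ∈ X} (-wᵀ Γ(x)) + wᵀ v` of the Lagrangian dual. -/
def D2Objective (P : CVOP n m) (v w : Fin (m + 1) → ℝ) : EReal :=
  (⨆ x ∈ P.X, ((-(w ⬝ᵥ P.Γ x) : ℝ) : EReal)) + ((w ⬝ᵥ v : ℝ) : EReal)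

/-- `w` is an optimal solution of the Lagrangian dual. -/
def D2Optimal (P : CVOP n m) (v d w : Fin (m + 1) → ℝ) : Prop :=
  P.D2Feasible d w ∧ ∀ w', P.D2Feasible d w' → P.D2Objective v w ≤ P.D2Objective v w'

end CVOP

/-! ### The geometric dual problem -/

section GeometricDual

variable {n m : ℕ}

/-- `w(t) = ((t₁, …, t_{q-1}, 1) T⁻¹)ᵀ`. -/
def wOf (T : Matrix (Fin (m + 1)) (Fin (m + 1)) ℝ) (t : Fin (m + 1) → ℝ) : Fin (m + 1) → ℝ :=
  Function.update t (Fin.last m) 1 ᵥ* T⁻¹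

/-- The space `ℝ^{q-1} × [-∞, ∞]` in which the dual objective takes its values. -/
abbrev ExtSpace (m : ℕ) : Type := (Fin m → ℝ) × EReal

/-- The inclusion `ℝ^q ⊆ ℝ^{q-1} × [-∞, ∞]`. -/
def toExt (y : Fin (m + 1) → ℝ) : ExtSpace m := (Fin.init y, ((y (Fin.last m) : ℝ) : EReal))

/-- `y + k e^q` in `ℝ^{q-1} × [-∞, ∞]`. -/
def shift (y : ExtSpace m) (k : ℝ) : ExtSpace m := (y.1, y.2 + (k : EReal))

/-- The dual ordering cone `K = ℝ₊ e^q`. -/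
def coneK (m : ℕ) : Set (Fin (m + 1) → ℝ) := {y | ∃ k : ℝ, 0 ≤ k ∧ y = Pi.single (Fin.last m) k}

/-- The dual objective `D*(t) = (t₁, …, t_{q-1}, inf_{x ∈ X} w(t)ᵀ Γ(x))`. -/
def dualObjective (P : CVOP n m) (T : Matrix (Fin (m + 1)) (Fin (m + 1)) ℝ)
    (t : Fin (m + 1) → ℝ) : ExtSpace m :=
  (Fin.init t, ⨅ x ∈ P.X, ((wOf T t ⬝ᵥ P.Γ x : ℝ) : EReal))

/-- The feasible region `{t | w(t) ∈ A⁺}` of the geometric dual problem with ordering cone `A` in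
the primal image space. -/
def dualFeasible (T : Matrix (Fin (m + 1)) (Fin (m + 1)) ℝ) (A : Set (Fin (m + 1) → ℝ)) :
    Set (Fin (m + 1) → ℝ) :=
  {t | wOf T t ∈ dualCone A}

/-- The lower image `D*(𝒯) - K`. -/
def lowerImage (P : CVOP n m) (T : Matrix (Fin (m + 1)) (Fin (m + 1)) ℝ)
    (A : Set (Fin (m + 1) → ℝ)) : Set (ExtSpace m) :=
  {y | ∃ t ∈ dualFeasible T A, ∃ k : ℝ, 0 ≤ k ∧ y = shift (dualObjective P T t) (-k)}

/-- `t` is feasible and `D*(t)` is a `K`-maximal element of `D*(𝒯)`, that is,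
`({D*(t)} + K \ {0}) ∩ D*(𝒯) = ∅`. (This forces the last entry of `D*(t)` to be finite.) -/
def IsDualMaximizer (P : CVOP n m) (T : Matrix (Fin (m + 1)) (Fin (m + 1)) ℝ)
    (A : Set (Fin (m + 1) → ℝ)) (t : Fin (m + 1) → ℝ) : Prop :=
  t ∈ dualFeasible T A ∧
    ∀ k : ℝ, 0 < k → shift (dualObjective P T t) k ∉ dualObjective P T '' dualFeasible T A

/-- `Tbar` is a finite `ε`-solution of: maximize `D*(t)` w.r.t. `≤_K` subject to `w(t) ∈ A⁺`.
All points of `D*(Tbar)` lie in `ℝ^q`, so their convex hull is formed there. -/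
structure IsFiniteDualEpsSolution (P : CVOP n m) (T : Matrix (Fin (m + 1)) (Fin (m + 1)) ℝ)
    (A : Set (Fin (m + 1) → ℝ)) (ε : ℝ) (Tbar : Set (Fin (m + 1) → ℝ)) : Prop where
  finite : Tbar.Finite
  maximizers : ∀ t ∈ Tbar, IsDualMaximizer P T A t
  approx : lowerImage P T A ⊆
    toExt '' (convexHull ℝ (toExt ⁻¹' (dualObjective P T '' Tbar)) - coneK m
      + {Pi.single (Fin.last m) ε})

/-- `(Tbar, Y)` is a finite `(ε, δ)`-solution of the geometric dual problem: `Y` is a finite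
`δ`-outer approximation and `Tbar` is a finite `ε`-solution of the dual problem modified by
replacing the constraint `w(t) ∈ C⁺` by `w(t) ∈ (cone Y)⁺`. -/
structure IsFiniteDualSolution (P : CVOP n m) (T : Matrix (Fin (m + 1)) (Fin (m + 1)) ℝ)
    (ε δ : ℝ) (Tbar Y : Set (Fin (m + 1) → ℝ)) : Prop where
  finite_Y : Y.Finite
  outer : P.IsOuterApprox δ Y
  eps_solution : IsFiniteDualEpsSolution P T (cone Y) ε Tbar

end GeometricDual

/-! ### Control flow: terminating runs of (nondeterministic) programs as relations on states -/

/-- Running `body a` successively for the entries `a` of a list. -/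
inductive RunList {α σ : Type} (body : α → σ → σ → Prop) : List α → σ → σ → Prop
  | nil (s : σ) : RunList body [] s s
  | cons {a : α} {l : List α} {s s' s'' : σ} :
      body a s s' → RunList body l s' s'' → RunList body (a :: l) s s''

/-- "For all `a ∈ A` do `body a`", in some order, each element once. -/
def ForEach {α σ : Type} (A : Set α) (body : α → σ → σ → Prop) (s s' : σ) : Prop :=
  ∃ l : List α, l.Nodup ∧ (∀ a, a ∈ l ↔ a ∈ A) ∧ RunList body l s s'

/-- "While `cond` do `body`", terminating after finitely many rounds. -/
def While {σ : Type} (cond : σ → Prop) (body : σ → σ → Prop) (s s' : σ) : Prop :=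
  Relation.ReflTransGen (fun a b => cond a ∧ body a b) s s' ∧ ¬ cond s'

/-! ### Parameters of the algorithms -/

/-- The fixed data: the direction `c`, the matrix `T`, generating directions `R` of `C` and
`Rstar` of `C⁺`. -/
structure Params (m : ℕ) where
  c : Fin (m + 1) → ℝ
  T : Matrix (Fin (m + 1)) (Fin (m + 1)) ℝ
  R : Finset (Fin (m + 1) → ℝ)
  Rstar : Finset (Fin (m + 1) → ℝ)

/-- The requirements on the fixed data. -/
structure Params.Admissible {n m : ℕ} (p : Params m) (P : CVOP n m) : Prop where
  c_mem : p.c ∈ interior (P.C : Set (Fin (m + 1) → ℝ))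
  c_norm : l1norm p.c = 1
  T_nonsingular : IsUnit p.T.det
  T_last_column : ∀ i, p.T i (Fin.last m) = p.c i
  R_generates : cone (p.R : Set (Fin (m + 1) → ℝ)) = (P.C : Set (Fin (m + 1) → ℝ))
  R_norm : ∀ d ∈ p.R, l1norm d = 1
  Rstar_generates : cone (p.Rstar : Set (Fin (m + 1) → ℝ)) =
    dualCone (P.C : Set (Fin (m + 1) → ℝ))
  Rstar_norm : ∀ z ∈ p.Rstar, p.c ⬝ᵥ z = 1

/-! ### The initialization algorithm: outer approximation of the recession cone -/

/-- The variables of the initialization algorithm. -/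
structure InitState (n m : ℕ) where
  YIn : Set (Fin (m + 1) → ℝ)
  YOut : Set (Fin (m + 1) → ℝ)
  Chat : Set (Fin (m + 1) → ℝ)
  P0 : Set (Fin (m + 1) → ℝ)
  Xbar : Set (Fin n → ℝ)
  Tbar : Set (Fin (m + 1) → ℝ)
  b : Bool

section InitAlgorithm

variable {n m : ℕ}

/-- Initial values of the variables (`YOut` is assigned before it is first read). -/
def initStart (p : Params m) : InitState n m where
  YIn := p.R
  YOut := ∅
  Chat := ∅
  P0 := univ
  Xbar := ∅
  Tbar := ∅
  b := true

/-- Update by an optimal point `x` and a weight `w`: store `x`, store the normalized dual point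
`Tᵀ (w / cᵀw)`, and cut `P0` with `{y | wᵀ (y - Γ(x)) ≥ 0}`. -/
def InitState.cut (P : CVOP n m) (p : Params m) (x : Fin n → ℝ) (w : Fin (m + 1) → ℝ)
    (s : InitState n m) : InitState n m :=
  { s with
    Xbar := insert x s.Xbar
    Tbar := insert (p.Tᵀ *ᵥ ((p.c ⬝ᵥ w)⁻¹ • w)) s.Tbar
    P0 := s.P0 ∩ {y | 0 ≤ w ⬝ᵥ (y - P.Γ x)} }

/-- Boundedness check for `z ∈ Rstar`. Here `cᵀz = 1`, so the dual point stored is `Tᵀ z`. -/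
def checkBounded (P : CVOP n m) (p : Params m) (z : Fin (m + 1) → ℝ)
    (s s' : InitState n m) : Prop :=
  (¬ P.P1Bounded z ∧ s' = { s with b := false }) ∨
  (∃ x, P.P1Optimal z x ∧ s' = s.cut P p x z)

/-- Check for lineality directions, for `d ∈ -R`. -/
def checkLineality (P : CVOP n m) (p : Params m) (v d : Fin (m + 1) → ℝ)
    (s s' : InitState n m) : Prop :=
  (P.P2Unbounded v d ∧ s' = { s with YIn := insert d s.YIn }) ∨
  (∃ x z w, P.P2Optimal v d x z ∧ P.D2Optimal v d w ∧ s' = s.cut P p x w)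

/-- `YOut ← vert ((P0)_∞ ∩ B₁(0)) \ {0}`. -/
def InitState.recomputeYOut (s : InitState n m) : InitState n m :=
  { s with YOut := outerDirections s.P0 }

/-- Loop condition of the iteration phase. -/
def initCond (s : InitState n m) : Prop := (s.YOut \ (s.YIn ∪ s.Chat)).Nonempty

/-- One round of the iteration phase. The number `λ ∈ (0,1)` may be chosen anew in each round; the
direction of the Pascoletti-Serafini problem has to be nonzero. -/
def initBody (P : CVOP n m) (p : Params m) (δ : ℝ) (v : Fin (m + 1) → ℝ)
    (s s' : InitState n m) : Prop :=
  ∃ d ∈ s.YOut \ (s.YIn ∪ s.Chat), ∃ r ∈ s.YIn, (∀ r' ∈ s.YIn, l1norm (d - r) ≤ l1norm (d - r')) ∧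
    ((l1norm (d - r) ≤ δ ∧ s' = { s with Chat := insert d s.Chat }) ∨
     (δ < l1norm (d - r) ∧ ∃ lam : ℝ, 0 < lam ∧ lam < 1 ∧
       ∃ e, e = lam • d + (1 - lam) • r ∧ e ≠ 0 ∧
        ((P.P2Unbounded v e ∧ s' = { s with YIn := insert ((l1norm e)⁻¹ • e) s.YIn }) ∨
         (∃ x z w, P.P2Optimal v e x z ∧ P.D2Optimal v e w ∧
            s' = (s.cut P p x w).recomputeYOut))))

/-- A terminating run of the initialization algorithm on a feasible problem, with output `out`. -/
def InitRun (P : CVOP n m) (p : Params m) (δ : ℝ) (out : InitState n m) : Prop :=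
  ∃ x₀ ∈ P.X, ∃ s₁ : InitState n m,
    ForEach (p.Rstar : Set (Fin (m + 1) → ℝ)) (checkBounded P p) (initStart p) s₁ ∧
    ((s₁.b = true ∧ out = { s₁ with YOut := p.R }) ∨
     (s₁.b = false ∧ ∃ s₂ : InitState n m,
        ForEach (-(p.R : Set (Fin (m + 1) → ℝ))) (checkLineality P p (P.Γ x₀ + ∑ d ∈ p.R, d))
          s₁ s₂ ∧
        While initCond (initBody P p δ (P.Γ x₀ + ∑ d ∈ p.R, d)) s₂.recomputeYOut out))

end InitAlgorithm

/-! ### The dual algorithm -/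

/-- The variables of the main loop of the dual algorithm; `D` is the current outer approximation
`D_k`. -/
structure DualState (n m : ℕ) where
  D : Set (Fin (m + 1) → ℝ)
  M : Set (Fin (m + 1) → ℝ)
  Xbar : Set (Fin n → ℝ)
  Tbar : Set (Fin (m + 1) → ℝ)

section DualAlgorithm

variable {n m : ℕ}

/-- The initial outer approximation `D_0` of the lower image. -/
def initialD (P : CVOP n m) (p : Params m) (s : InitState n m) : Set (Fin (m + 1) → ℝ) :=
  {t | wOf p.T t ∈ dualCone (cone s.YOut)} ∩
    ⋂ x ∈ s.Xbar, {t | 0 ≤ wOf p.T t ⬝ᵥ P.Γ x - t (Fin.last m)}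

/-- The additional test: the weighted sum problems are bounded for all extreme directions of
`(cone YOut)⁺`. -/
def dualTest (P : CVOP n m) (YOut : Set (Fin (m + 1) → ℝ)) : Prop :=
  ∀ w, IsExtremeDirection (dualCone (cone YOut)) w → P.P1Bounded w

/-- Processing a vertex `v` of the current outer approximation. -/
def processVertex (P : CVOP n m) (p : Params m) (ε : ℝ) (v : Fin (m + 1) → ℝ)
    (s s' : DualState n m) : Prop :=
  ∃ x, P.P1Optimal (wOf p.T v) x ∧
    ((ε < v (Fin.last m) - wOf p.T v ⬝ᵥ P.Γ x ∧
      s' = { s with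
        Xbar := insert x s.Xbar
        Tbar := insert (p.Tᵀ *ᵥ wOf p.T v) s.Tbar
        M := s.M ∩ {t | t (Fin.last m) ≤ wOf p.T t ⬝ᵥ P.Γ x} }) ∨
     (v (Fin.last m) - wOf p.T v ⬝ᵥ P.Γ x ≤ ε ∧
      s' = { s with
        Xbar := insert x s.Xbar
        Tbar := insert (p.Tᵀ *ᵥ wOf p.T v) s.Tbar }))

/-- One round of the main loop. -/
def dualBody (P : CVOP n m) (p : Params m) (ε : ℝ) (s s' : DualState n m) : Prop :=
  ∃ s₁ : DualState n m,
    ForEach (s.D.extremePoints ℝ) (processVertex P p ε) { s with M := univ } s₁ ∧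
    ((s₁.M ≠ univ ∧ s' = { s₁ with D := s₁.D ∩ s₁.M }) ∨ (s₁.M = univ ∧ s' = s₁))

/-- The dual algorithm terminates after passing the additional test, with output
`Xbar`, `YOut`, `Tbar`. -/
def DualAlgorithmOutputs (P : CVOP n m) (p : Params m) (ε δ : ℝ)
    (Xbar : Set (Fin n → ℝ)) (YOut Tbar : Set (Fin (m + 1) → ℝ)) : Prop :=
  ∃ s₀ : InitState n m, InitRun P p δ s₀ ∧ dualTest P s₀.YOut ∧
    ∃ s : DualState n m,
      While (fun a : DualState n m => a.M ≠ univ) (dualBody P p ε)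
        { D := initialD P p s₀, M := ∅, Xbar := s₀.Xbar, Tbar := s₀.Tbar } s ∧
      Xbar = s.Xbar ∧ YOut = s₀.YOut ∧ Tbar = s.Tbar

end DualAlgorithm

end

end UnboundedCVOP

/-!
Every cut made by the initialization algorithm supports the upper image: for (P₁) this is the
definition of an optimal solution, for (P₂) and (D₂) it is strong duality with Slater point `v`.
The outer cone is therefore the recession cone of a polyhedron containing the upper image, it is
generated by the directions `Y_Out`, and each of these is within `δ` of a unit recession direction.

The weights `w(t)` of dual feasible points lie in the section `wᵀc = 1` of the cone
`(cone Y_Out)⁺`. This section is compact because `c` is interior to `cone Y_Out`, so every `D_k`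
is bounded up to `-K` and lies below the convex hull of its vertices. When all vertices pass the
`ε`-test, `D_k` therefore exceeds the lower image by at most `ε`. A hyperplane separating a point
of the upper image from the primal inner approximation is itself a point of `D_k`, which transfers
the bound to the primal problem.
-/

namespace UnboundedCVOP

/-! ### Dot products, cones and dual cones -/

section DotProduct

variable {ι : Type*} [Fintype ι] {A : Set (ι → ℝ)} {y : ι → ℝ}

lemma continuous_dotProduct_left (w : ι → ℝ) : Continuous fun y : ι → ℝ => w ⬝ᵥ y :=
  continuous_const.dotProduct continuous_id

lemma exists_forall_eq_dotProduct (f : StrongDual ℝ (ι → ℝ)) :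
    ∃ w : ι → ℝ, ∀ y, f y = w ⬝ᵥ y := by
  classical
  refine ⟨(dotProductEquiv ℝ ι).symm f.toLinearMap, fun y => ?_⟩
  exact (LinearMap.congr_fun ((dotProductEquiv ℝ ι).apply_symm_apply f.toLinearMap) y).symm

lemma exists_dotProduct_lt_of_notMem (hA : Convex ℝ A) (hc : IsClosed A) (hy : y ∉ A) :
    ∃ (w : ι → ℝ) (γ : ℝ), w ⬝ᵥ y < γ ∧ ∀ a ∈ A, γ < w ⬝ᵥ a := by
  obtain ⟨f, γ, hfy, hfA⟩ := geometric_hahn_banach_point_closed hA hc hy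
  obtain ⟨w, hw⟩ := exists_forall_eq_dotProduct f
  exact ⟨w, γ, hw y ▸ hfy, fun a ha => hw a ▸ hfA a ha⟩

lemma exists_dotProduct_le_of_notMem_interior (hA : Convex ℝ A) (hint : (interior A).Nonempty)
    (hy : y ∉ interior A) : ∃ w : ι → ℝ, w ≠ 0 ∧ ∀ a ∈ A, w ⬝ᵥ y ≤ w ⬝ᵥ a := by
  obtain ⟨f, hf, hfA⟩ := geometric_hahn_banach_of_nonempty_interior_point hA hy hint
  obtain ⟨w, hw⟩ := exists_forall_eq_dotProduct f
  refine ⟨-w, fun h0 => hf (ContinuousLinearMap.ext fun y => ?_), fun a ha => ?_⟩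
  · rw [hw, neg_eq_zero.1 h0, zero_dotProduct, _root_.zero_apply]
  · rw [neg_dotProduct, neg_dotProduct, ← hw, ← hw]
    exact neg_le_neg (hfA a ha)

end DotProduct

lemma nonneg_of_forall_lt_add_mul {K : Type*} [Field K] [LinearOrder K] [IsStrictOrderedRing K]
    {a b γ : K} (h : ∀ k : K, 0 ≤ k → γ < b + k * a) : 0 ≤ a := by
  by_contra! ha
  have hlt := h _ (le_max_left 0 ((γ - b) / a))
  have hle := (div_le_iff_of_neg ha).1 (le_max_right 0 ((γ - b) / a))
  linarith

lemma exists_pos_add_smul_mem {E : Type*} [AddCommGroup E] [Module ℝ E] [TopologicalSpace E]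
    [ContinuousAdd E] [ContinuousSMul ℝ E] {A : Set E} {y : E} (hy : y ∈ interior A) (d : E) :
    ∃ η : ℝ, 0 < η ∧ y + η • d ∈ A := by
  have hcont : Continuous fun η : ℝ => y + η • d := by fun_prop
  have hA : ∀ᶠ η in nhdsWithin (0 : ℝ) (Ioi 0), y + η • d ∈ A :=
    (hcont.tendsto' 0 y (by simp)).mono_left nhdsWithin_le_nhds (mem_interior_iff_mem_nhds.1 hy)
  obtain ⟨η, hη, hpos⟩ := (hA.and self_mem_nhdsWithin).exists
  exact ⟨η, hpos, hη⟩

lemma lt_dotProduct_of_mem_interior {ι : Type*} [Fintype ι] {A : Set (ι → ℝ)} {w y : ι → ℝ}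
    {γ : ℝ} (h0 : w ≠ 0) (hw : ∀ a ∈ A, γ ≤ w ⬝ᵥ a) (hy : y ∈ interior A) : γ < w ⬝ᵥ y := by
  obtain ⟨η, hη, hmem⟩ := exists_pos_add_smul_mem hy (-w)
  have hle := hw _ hmem
  rw [dotProduct_add, dotProduct_smul, dotProduct_neg, smul_eq_mul] at hle
  have hself : 0 < w ⬝ᵥ w := by simpa using Matrix.dotProduct_star_self_pos_iff.2 h0
  nlinarith [mul_pos hη hself]

section Cone

variable {q : ℕ} {A B Y : Set (Fin q → ℝ)} {a z w c : Fin q → ℝ} {k : ℝ}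

lemma subset_cone (Y : Set (Fin q → ℝ)) : Y ⊆ cone Y := PointedCone.subset_hull

lemma zero_mem_cone (Y : Set (Fin q → ℝ)) : (0 : Fin q → ℝ) ∈ cone Y :=
  (PointedCone.hull ℝ Y).zero_mem

lemma smul_mem_cone (hk : 0 ≤ k) (ha : a ∈ cone Y) : k • a ∈ cone Y :=
  (PointedCone.hull ℝ Y).smul_mem hk ha

lemma convex_cone (Y : Set (Fin q → ℝ)) : Convex ℝ (cone Y) := (PointedCone.hull ℝ Y).convex

lemma cone_subset (h0 : 0 ∈ A) (hadd : ∀ a ∈ A, ∀ b ∈ A, a + b ∈ A)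
    (hsmul : ∀ k : ℝ, 0 ≤ k → ∀ a ∈ A, k • a ∈ A) (hY : Y ⊆ A) : cone Y ⊆ A := fun _ hy =>
  Submodule.span_induction (R := {c : ℝ // 0 ≤ c}) (p := fun y _ => y ∈ A)
    (fun _ hy => hY hy) h0 (fun a b _ _ ha hb => hadd a ha b hb)
    (fun k a _ ha => hsmul k k.2 a ha) hy

lemma smul_mem_dualCone (hk : 0 ≤ k) (hz : z ∈ dualCone A) : k • z ∈ dualCone A := fun a ha => by
  rw [smul_dotProduct]
  exact mul_nonneg hk (hz a ha)

lemma add_mem_dualCone (hz : z ∈ dualCone A) (hw : w ∈ dualCone A) : z + w ∈ dualCone A :=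
  fun a ha => by
    rw [add_dotProduct]
    exact add_nonneg (hz a ha) (hw a ha)

lemma convex_dualCone (A : Set (Fin q → ℝ)) : Convex ℝ (dualCone A) :=
  fun _ hx _ hy _ _ ha hb _ => add_mem_dualCone (smul_mem_dualCone ha hx) (smul_mem_dualCone hb hy)

lemma isClosed_dualCone (A : Set (Fin q → ℝ)) : IsClosed (dualCone A) := by
  simp only [dualCone, ofPred_forall]
  exact isClosed_biInter fun a _ =>
    isClosed_le continuous_const (continuous_id.dotProduct continuous_const)

lemma dualCone_anti (h : A ⊆ B) : dualCone B ⊆ dualCone A := fun _ hz a ha => hz a (h ha)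

lemma cone_subset_dualCone (h : Y ⊆ dualCone A) : cone Y ⊆ dualCone A :=
  cone_subset (fun a _ => by rw [zero_dotProduct]) (fun _ ha _ hb => add_mem_dualCone ha hb)
    (fun _ hk _ ha => smul_mem_dualCone hk ha) h

lemma dualCone_cone (Y : Set (Fin q → ℝ)) : dualCone (cone Y) = dualCone Y := by
  refine (dualCone_anti (subset_cone Y)).antisymm fun z hz a ha => ?_
  have hY : Y ⊆ dualCone {z} := fun y hy => by
    rintro _ rfl
    rw [dotProduct_comm]
    exact hz y hy
  rw [dotProduct_comm]
  exact cone_subset_dualCone hY ha z rfl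

lemma dotProduct_pos_of_mem_interior (hw : w ∈ dualCone A) (h0 : w ≠ 0) (hc : c ∈ interior A) :
    0 < w ⬝ᵥ c :=
  lt_dotProduct_of_mem_interior h0 hw hc

lemma isCompact_dualCone_section (hc : c ∈ interior A) :
    IsCompact {w | w ∈ dualCone A ∧ w ⬝ᵥ c = 1} := by
  refine Metric.isCompact_of_isClosed_isBounded ((isClosed_dualCone A).inter
    (isClosed_eq (continuous_id.dotProduct continuous_const) continuous_const)) ?_
  obtain ⟨ρ, hρ, hball⟩ := Metric.nhds_basis_closedBall.mem_iff.1 (mem_interior_iff_mem_nhds.1 hc)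
  refine isBounded_iff_forall_norm_le.2 ⟨1 / ρ, fun w ⟨hw, hwc⟩ => ?_⟩
  have hcoord (i : Fin q) (s : ℝ) (hs : |s| = ρ) : 0 ≤ 1 + w i * s := by
    have hmem : c + Pi.single i s ∈ A := hball <| by
      rw [Metric.mem_closedBall, dist_eq_norm, add_sub_cancel_left, Pi.norm_single,
        Real.norm_eq_abs, hs]
    simpa only [dotProduct_add, hwc, dotProduct_single] using hw _ hmem
  refine (pi_norm_le_iff_of_nonneg (by positivity)).2 fun i => ?_
  rw [Real.norm_eq_abs, le_div_iff₀ hρ, ← abs_of_pos hρ, ← abs_mul, abs_le]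
  have hpos := hcoord i ρ (abs_of_pos hρ)
  have hneg := hcoord i (-ρ) (by rw [abs_neg, abs_of_pos hρ])
  constructor <;> linarith

end Cone

/-! ### Recession cones -/

section Recession

variable {q : ℕ} {A Y : Set (Fin q → ℝ)} {d e w : Fin q → ℝ} {k γ : ℝ}

lemma zero_mem_recessionCone : (0 : Fin q → ℝ) ∈ recessionCone A :=
  fun y hy α _ => by rwa [smul_zero, add_zero]

lemma add_mem_recessionCone (hd : d ∈ recessionCone A) (he : e ∈ recessionCone A) :
    d + e ∈ recessionCone A := fun y hy α hα => by
  rw [smul_add, ← add_assoc]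
  exact he _ (hd y hy α hα) α hα

lemma smul_mem_recessionCone (hk : 0 ≤ k) (hd : d ∈ recessionCone A) :
    k • d ∈ recessionCone A := fun y hy α hα => by
  rw [smul_smul]
  exact hd y hy _ (mul_nonneg hα hk)

lemma convex_recessionCone : Convex ℝ (recessionCone A) := fun _ hx _ hy _ _ ha hb _ =>
  add_mem_recessionCone (smul_mem_recessionCone ha hx) (smul_mem_recessionCone hb hy)

lemma cone_subset_recessionCone (h : Y ⊆ recessionCone A) : cone Y ⊆ recessionCone A :=
  cone_subset zero_mem_recessionCone (fun _ ha _ hb => add_mem_recessionCone ha hb)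
    (fun _ hk _ ha => smul_mem_recessionCone hk ha) h

lemma subset_recessionCone (A : PointedCone ℝ (Fin q → ℝ)) :
    (A : Set (Fin q → ℝ)) ⊆ recessionCone (A : Set (Fin q → ℝ)) :=
  fun _ hd _ hy _ hα => A.add_mem hy (A.smul_mem hα hd)

lemma recessionCone_eq_univ_of_zero_mem_interior (h : 0 ∈ interior (recessionCone A)) :
    recessionCone A = univ := by
  refine eq_univ_of_forall fun d => ?_
  obtain ⟨η, hη, hmem⟩ := exists_pos_add_smul_mem h d
  rw [zero_add] at hmem
  simpa [smul_smul, hη.ne'] using smul_mem_recessionCone (inv_nonneg.2 hη.le) hmem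

lemma recessionCone_neg (A : Set (Fin q → ℝ)) : recessionCone (-A) = -recessionCone A := by
  ext d
  constructor
  · intro hd y hy α hα
    simpa [add_comm] using hd (-y) (by simpa using hy) α hα
  · intro hd y hy α hα
    simpa [add_comm] using hd (-y) hy α hα

lemma recessionCone_eq_univ_of_neg_subset {C : Set (Fin q → ℝ)} (hint : (interior C).Nonempty)
    (hC : C ⊆ recessionCone A) (hneg : -C ⊆ recessionCone A) : recessionCone A = univ := by
  obtain ⟨c, hc⟩ := hint
  have hsub : C + -C ⊆ recessionCone A := by
    rintro _ ⟨a, ha, b, hb, rfl⟩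
    exact add_mem_recessionCone (hC ha) (hneg hb)
  refine recessionCone_eq_univ_of_zero_mem_interior (interior_mono hsub ?_)
  exact subset_interior_add_left
    ⟨c, hc, -c, neg_mem_neg.2 (interior_subset hc), add_neg_cancel c⟩

lemma recessionCone_subset_recessionCone_closure (A : Set (Fin q → ℝ)) :
    recessionCone A ⊆ recessionCone (closure A) := fun d hd _ hy α hα =>
  map_mem_closure (f := fun y => y + α • d) (by fun_prop) hy fun y hy => hd y hy α hα

lemma mem_recessionCone_of_not_bddAbove {v : Fin q → ℝ} (hA : Convex ℝ A) (hc : IsClosed A)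
    (h : ¬ BddAbove {z : ℝ | v + z • d ∈ A}) : d ∈ recessionCone A := by
  have hd : d ∈ asymptoticCone ℝ A := by
    refine ((Filter.tendsto_id.atTop_smul_const_tendsto_asymptoticNhds d).asymptoticNhds_vadd_const
      v).frequently (Filter.frequently_atTop.2 fun z₀ => ?_)
    obtain ⟨z, hz, hlt⟩ := not_bddAbove_iff.1 h z₀
    exact ⟨z, hlt.le, by simpa only [id, vadd_eq_add, add_comm v, mem_ofPred_eq] using hz⟩
  intro y hy α hα
  rw [add_comm]
  exact hA.smul_vadd_mem_of_isClosed_of_mem_asymptoticCone hc hα hd hy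

lemma eq_univ_of_recessionCone_eq_univ (hA : A.Nonempty) (h : recessionCone A = univ) :
    A = univ := by
  obtain ⟨y, hy⟩ := hA
  refine eq_univ_of_forall fun z => ?_
  have hz : z - y ∈ recessionCone A := h ▸ mem_univ _
  simpa using hz y hy 1 zero_le_one

lemma mem_dualCone_recessionCone (hA : A.Nonempty) (hw : ∀ y ∈ A, γ ≤ w ⬝ᵥ y) :
    w ∈ dualCone (recessionCone A) := by
  obtain ⟨y, hy⟩ := hA
  intro d hd
  refine nonneg_of_forall_lt_add_mul (γ := γ - 1) (b := w ⬝ᵥ y) fun k hk => ?_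
  have hγ := hw _ (hd y hy k hk)
  rw [dotProduct_add, dotProduct_smul, smul_eq_mul] at hγ
  linarith

lemma mem_dualCone_of_forall_le {A : PointedCone ℝ (Fin q → ℝ)}
    (hw : ∀ a ∈ A, γ ≤ w ⬝ᵥ a) : w ∈ dualCone (A : Set (Fin q → ℝ)) :=
  dualCone_anti (subset_recessionCone A) (mem_dualCone_recessionCone ⟨0, A.zero_mem⟩ hw)

lemma dualCone_dualCone {A : PointedCone ℝ (Fin q → ℝ)} (hA : IsClosed (A : Set (Fin q → ℝ))) :
    dualCone (dualCone (A : Set (Fin q → ℝ))) = A := by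
  refine Subset.antisymm (fun y hy => ?_) fun a ha z hz => dotProduct_comm a z ▸ hz a ha
  by_contra hyA
  obtain ⟨w, γ, hwy, hwA⟩ := exists_dotProduct_lt_of_notMem A.convex hA hyA
  have hγ : γ < 0 := by simpa only [dotProduct_zero] using hwA 0 A.zero_mem
  have hyw : 0 ≤ y ⬝ᵥ w := hy w (mem_dualCone_of_forall_le fun a ha => (hwA a ha).le)
  rw [dotProduct_comm] at hyw
  linarith

lemma sum_mem_interior_cone {R : Finset (Fin q → ℝ)}
    (hint : (interior (cone (R : Set (Fin q → ℝ)))).Nonempty) :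
    ∑ d ∈ R, d ∈ interior (cone (R : Set (Fin q → ℝ))) := by
  by_contra hnot
  obtain ⟨w, hw0, hw⟩ := exists_dotProduct_le_of_notMem_interior (convex_cone _) hint hnot
  have hdual : w ∈ dualCone (cone (R : Set (Fin q → ℝ))) := mem_dualCone_of_forall_le hw
  have hnonneg : ∀ d ∈ R, 0 ≤ w ⬝ᵥ d := fun d hd => hdual d (subset_cone _ hd)
  have hsum : ∑ d ∈ R, w ⬝ᵥ d ≤ 0 := by
    rw [← dotProduct_sum]
    simpa only [dotProduct_zero] using hw 0 (zero_mem_cone _)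
  have hzero : ∀ d ∈ R, w ⬝ᵥ d = 0 := (Finset.sum_eq_zero_iff_of_nonneg hnonneg).1
    (hsum.antisymm (Finset.sum_nonneg hnonneg))
  have hneg : -w ∈ dualCone (cone (R : Set (Fin q → ℝ))) := by
    rw [dualCone_cone]
    exact fun d hd => by rw [neg_dotProduct, hzero d hd, neg_zero]
  obtain ⟨c, hc⟩ := hint
  have hc_nonpos := hneg c (interior_subset hc)
  rw [neg_dotProduct] at hc_nonpos
  linarith [dotProduct_pos_of_mem_interior hdual hw0 hc]

end Recession

/-! ### The `ℓ₁` norm -/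

section L1Norm

variable {q : ℕ} {y : Fin q → ℝ}

lemma l1norm_zero : l1norm (0 : Fin q → ℝ) = 0 := by
  simp only [l1norm, Pi.zero_apply, abs_zero, Finset.sum_const_zero]

lemma l1norm_smul (k : ℝ) (y : Fin q → ℝ) : l1norm (k • y) = |k| * l1norm y := by
  simp only [l1norm, Pi.smul_apply, smul_eq_mul, abs_mul, Finset.mul_sum]

lemma l1norm_add_le (x y : Fin q → ℝ) : l1norm (x + y) ≤ l1norm x + l1norm y := by
  unfold l1norm
  rw [← Finset.sum_add_distrib]
  exact Finset.sum_le_sum fun i _ => abs_add_le _ _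

lemma l1norm_neg (y : Fin q → ℝ) : l1norm (-y) = l1norm y := by
  simp only [l1norm, Pi.neg_apply, abs_neg]

lemma l1norm_pos (hy : y ≠ 0) : 0 < l1norm y := by
  obtain ⟨i, hi⟩ := Function.ne_iff.1 hy
  exact Finset.sum_pos' (fun _ _ => abs_nonneg _) ⟨i, Finset.mem_univ _, abs_pos.2 hi⟩

lemma l1norm_inv_smul_self (hy : y ≠ 0) : l1norm ((l1norm y)⁻¹ • y) = 1 := by
  have hpos := l1norm_pos hy
  rw [l1norm_smul, abs_of_pos (inv_pos.2 hpos), inv_mul_cancel₀ hpos.ne']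

lemma continuous_l1norm : Continuous (l1norm : (Fin q → ℝ) → ℝ) := by
  unfold l1norm; fun_prop

lemma convexOn_l1norm : ConvexOn ℝ univ (l1norm : (Fin q → ℝ) → ℝ) := by
  refine ⟨convex_univ, fun x _ y _ a b ha hb _ => (l1norm_add_le _ _).trans_eq ?_⟩
  rw [l1norm_smul, l1norm_smul, abs_of_nonneg ha, abs_of_nonneg hb, smul_eq_mul, smul_eq_mul]

lemma edist_toLp_one (x y : Fin q → ℝ) :
    edist (WithLp.toLp 1 x : PiLp 1 fun _ : Fin q => ℝ) (WithLp.toLp 1 y) =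
      ENNReal.ofReal (l1norm (x - y)) := by
  rw [edist_dist, dist_eq_norm, PiLp.norm_eq_of_L1]
  rfl

lemma l1Hausdorff_le_of_forall_exists {A B : Set (Fin q → ℝ)} {δ : ℝ}
    (hA : ∀ x ∈ A, ∃ y ∈ B, l1norm (x - y) ≤ δ) (hB : ∀ y ∈ B, ∃ x ∈ A, l1norm (y - x) ≤ δ) :
    l1Hausdorff A B ≤ ENNReal.ofReal δ := by
  refine Metric.hausdorffEDist_le_of_mem_edist ?_ ?_
  · rintro _ ⟨x, hx, rfl⟩
    obtain ⟨y, hy, hxy⟩ := hA x hx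
    exact ⟨_, ⟨y, hy, rfl⟩, (edist_toLp_one x y).trans_le (ENNReal.ofReal_le_ofReal hxy)⟩
  · rintro _ ⟨y, hy, rfl⟩
    obtain ⟨x, hx, hyx⟩ := hB y hy
    exact ⟨_, ⟨x, hx, rfl⟩, (edist_toLp_one y x).trans_le (ENNReal.ofReal_le_ofReal hyx)⟩

lemma isCompact_l1Ball : IsCompact (l1Ball q) := by
  refine Metric.isCompact_of_isClosed_isBounded
    (isClosed_le continuous_l1norm continuous_const) ?_
  refine isBounded_iff_forall_norm_le.2 ⟨1, fun y (hy : l1norm y ≤ 1) => ?_⟩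
  refine (pi_norm_le_iff_of_nonneg zero_le_one).2 fun i => le_trans ?_ hy
  exact Finset.single_le_sum (f := fun i => |y i|) (fun _ _ => abs_nonneg _) (Finset.mem_univ i)

lemma convex_l1Ball : Convex ℝ (l1Ball q) := by
  simpa only [mem_univ, true_and, l1Ball] using (convexOn_l1norm (q := q)).convex_le 1

lemma neg_l1norm_le_dotProduct_of_mem_pi {s : Fin q → ℝ}
    (hs : s ∈ Set.pi univ fun _ : Fin q => ({1, -1} : Set ℝ)) (y : Fin q → ℝ) :
    -l1norm y ≤ s ⬝ᵥ y := by
  unfold l1norm dotProduct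
  rw [← Finset.sum_neg_distrib]
  refine Finset.sum_le_sum fun i _ => ?_
  rcases hs i (mem_univ i) with h | h
  · rw [h, one_mul]
    exact neg_abs_le _
  · rw [h, neg_one_mul]
    exact neg_le_neg (le_abs_self _)

lemma exists_mem_pi_dotProduct_eq_neg_l1norm (y : Fin q → ℝ) :
    ∃ s ∈ Set.pi univ fun _ : Fin q => ({1, -1} : Set ℝ), s ⬝ᵥ y = -l1norm y := by
  refine ⟨fun i => if 0 ≤ y i then -1 else 1, fun i _ => ?_, ?_⟩
  · dsimp only
    split_ifs <;> simp
  · unfold dotProduct l1norm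
    rw [← Finset.sum_neg_distrib]
    refine Finset.sum_congr rfl fun i _ => ?_
    dsimp only
    split_ifs with hi
    · rw [abs_of_nonneg hi, neg_one_mul]
    · rw [abs_of_neg (not_le.1 hi), one_mul, neg_neg]

lemma mem_l1Ball_iff_forall_signs :
    y ∈ l1Ball q ↔ ∀ s ∈ Set.pi univ fun _ : Fin q => ({1, -1} : Set ℝ), -1 ≤ s ⬝ᵥ y := by
  refine ⟨fun hy s hs => (neg_le_neg hy).trans (neg_l1norm_le_dotProduct_of_mem_pi hs y),
    fun h => ?_⟩
  obtain ⟨s, hs, hsy⟩ := exists_mem_pi_dotProduct_eq_neg_l1norm y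
  exact neg_le_neg_iff.1 (hsy ▸ h s hs)

end L1Norm

/-! ### Extreme points of polyhedra -/

section Polyhedra

lemma finite_extremePoints_of_finite_halfspaces {ι : Type*} [Fintype ι] {F : Set ((ι → ℝ) × ℝ)}
    (hF : F.Finite) : ({y | ∀ f ∈ F, f.2 ≤ f.1 ⬝ᵥ y}.extremePoints ℝ).Finite := by
  -- Two extreme points with the same active constraints coincide: the segment between them can be
  -- prolonged beyond either end.
  refine Set.Finite.of_injOn (f := fun x => {f ∈ F | f.1 ⬝ᵥ x = f.2}) (t := 𝒫 F)
    (fun x _ => sep_subset _ _) (fun x hx y hy hxy => ?_) hF.finite_subsets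
  have hactive : ∀ f ∈ F, f.1 ⬝ᵥ x = f.2 → f.1 ⬝ᵥ y = f.2 := fun f hf hfx =>
    (Set.ext_iff.1 hxy f).1 ⟨hf, hfx⟩ |>.2
  have hopen : IsOpen {t | ∀ f ∈ F, f.1 ⬝ᵥ x ≠ f.2 → f.2 < f.1 ⬝ᵥ t} := by
    simp only [ofPred_forall]
    exact hF.isOpen_biInter fun f _ => isOpen_iInter_of_finite fun _ =>
      isOpen_lt continuous_const (continuous_dotProduct_left f.1)
  have hx_mem : x ∈ {t | ∀ f ∈ F, f.1 ⬝ᵥ x ≠ f.2 → f.2 < f.1 ⬝ᵥ t} :=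
    fun f hf hne => (hx.1 f hf).lt_of_ne' hne
  obtain ⟨η, hη, hinactive⟩ := exists_pos_add_smul_mem (hopen.interior_eq.symm ▸ hx_mem) (x - y)
  have hmem : x + η • (x - y) ∈ {y | ∀ f ∈ F, f.2 ≤ f.1 ⬝ᵥ y} := by
    intro f hf
    by_cases hfx : f.1 ⬝ᵥ x = f.2
    · rw [dotProduct_add, dotProduct_smul, dotProduct_sub, hfx, hactive f hf hfx, sub_self,
        smul_zero, add_zero]
    · exact (hinactive f hf hfx).le
  refine (((mem_extremePoints.1 hx).2 _ hmem y hy.1 ?_).2).symm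
  refine ⟨1 / (1 + η), η / (1 + η), by positivity, by positivity, by field_simp, ?_⟩
  ext i
  simp only [Pi.add_apply, Pi.smul_apply, Pi.sub_apply, smul_eq_mul]
  field_simp
  ring

variable {q : ℕ} {W A : Set (Fin q → ℝ)}

lemma finite_extremePoints_dualCone_inter_l1Ball (hW : W.Finite) :
    ((dualCone W ∩ l1Ball q).extremePoints ℝ).Finite := by
  have hhalfspaces : dualCone W ∩ l1Ball q = {y | ∀ f ∈ (fun w => (w, (0 : ℝ))) '' W ∪
      (fun s => (s, (-1 : ℝ))) '' (Set.pi univ fun _ : Fin q => ({1, -1} : Set ℝ)),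
      f.2 ≤ f.1 ⬝ᵥ y} := by
    ext y
    rw [mem_inter_iff, mem_l1Ball_iff_forall_signs]
    simp only [union_def, mem_ofPred_eq, or_imp, forall_and, forall_mem_image, dualCone,
      dotProduct_comm y]
  rw [hhalfspaces]
  exact finite_extremePoints_of_finite_halfspaces
    ((hW.image _).union ((Set.Finite.pi fun _ => toFinite _).image _))

lemma convexHull_extremePoints_dualCone_inter_l1Ball (hW : W.Finite) :
    convexHull ℝ ((dualCone W ∩ l1Ball q).extremePoints ℝ) = dualCone W ∩ l1Ball q := by
  rw [← ((finite_extremePoints_dualCone_inter_l1Ball hW).isClosed_convexHull ℝ).closure_eq]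
  exact closure_convexHull_extremePoints (isCompact_l1Ball.inter_left (isClosed_dualCone W))
    ((convex_dualCone W).inter convex_l1Ball)

lemma cone_outerDirections_of_recessionCone_eq (hW : W.Finite) (hA : recessionCone A = dualCone W) :
    cone (outerDirections A) = dualCone W := by
  unfold outerDirections
  rw [hA]
  refine (cone_subset_dualCone fun y hy => (extremePoints_subset hy.1).1).antisymm fun y hy => ?_
  have hball : dualCone W ∩ l1Ball q ⊆ cone ((dualCone W ∩ l1Ball q).extremePoints ℝ \ {0}) :=
    calc dualCone W ∩ l1Ball q = convexHull ℝ ((dualCone W ∩ l1Ball q).extremePoints ℝ) :=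
          (convexHull_extremePoints_dualCone_inter_l1Ball hW).symm
      _ ⊆ _ := convexHull_min (fun u hu => by
          rcases eq_or_ne u 0 with rfl | h0
          · exact zero_mem_cone _
          · exact subset_cone _ ⟨hu, h0⟩) (convex_cone _)
  rcases eq_or_ne y 0 with rfl | h0
  · exact zero_mem_cone _
  have hpos := l1norm_pos h0
  have hmem := hball ⟨smul_mem_dualCone (inv_nonneg.2 hpos.le) hy, (l1norm_inv_smul_self h0).le⟩
  simpa only [smul_inv_smul₀ hpos.ne'] using smul_mem_cone hpos.le hmem

end Polyhedra

/-! ### Sets bounded with respect to the dual ordering cone -/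

section KBounded

lemma exists_extremePoint_le_of_isCompact {E : Type*} [AddCommGroup E] [Module ℝ E]
    [TopologicalSpace E] [T2Space E] [IsTopologicalAddGroup E] [ContinuousSMul ℝ E]
    [LocallyConvexSpace ℝ E] {D : Set E} (l : StrongDual ℝ E) {t₀ : E} (ht₀ : t₀ ∈ D)
    (hcomp : IsCompact (D ∩ {t | l t₀ ≤ l t})) : ∃ u ∈ D.extremePoints ℝ, l t₀ ≤ l u := by
  obtain ⟨t₁, ht₁, hmax⟩ := hcomp.exists_isMaxOn ⟨t₀, ht₀, le_refl (l t₀)⟩ l.continuous.continuousOn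
  have ht₁_max : ∀ t ∈ D, l t ≤ l t₁ := fun t ht =>
    (le_total (l t₀) (l t)).elim (fun h => hmax ⟨ht, h⟩) fun h => h.trans ht₁.2
  have hface : l.toExposed D = (D ∩ {t | l t₀ ≤ l t}) ∩ {t | l t₁ ≤ l t} := by
    ext t
    exact ⟨fun ht => ⟨⟨ht.1, ht.2 t₀ ht₀⟩, ht.2 t₁ ht₁.1⟩,
      fun ht => ⟨ht.1.1, fun s hs => (ht₁_max s hs).trans ht.2⟩⟩
  have hface_comp : IsCompact (l.toExposed D) :=
    hface ▸ hcomp.inter_right (isClosed_le continuous_const l.continuous)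
  obtain ⟨u, hu⟩ := hface_comp.extremePoints_nonempty ⟨t₁, ht₁.1, ht₁_max⟩
  have hexp : IsExposed ℝ D (l.toExposed D) := ContinuousLinearMap.toExposed.isExposed
  exact ⟨u, hexp.isExtreme.extremePoints_subset_extremePoints hu,
    (extremePoints_subset hu).2 t₀ ht₀⟩

variable {m : ℕ} {D : Set (Fin (m + 1) → ℝ)} {g t₀ : Fin (m + 1) → ℝ}

lemma convex_coneK (m : ℕ) : Convex ℝ (coneK m) := by
  rintro _ ⟨k, hk, rfl⟩ _ ⟨l, hl, rfl⟩ a b ha hb _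
  refine ⟨a * k + b * l, by positivity, ?_⟩
  rw [Pi.single_add, ← Pi.single_smul, ← Pi.single_smul, smul_eq_mul, smul_eq_mul]

lemma isClosed_coneK (m : ℕ) : IsClosed (coneK m) := by
  have hK : coneK m = {y | 0 ≤ y (Fin.last m)} ∩
      {y | y = Pi.single (Fin.last m) (y (Fin.last m))} := by
    ext y
    exact ⟨by rintro ⟨k, hk, rfl⟩; simpa using hk, fun h => ⟨_, h.1, h.2⟩⟩
  rw [hK]
  exact (isClosed_le continuous_const (continuous_apply _)).inter (isClosed_eq continuous_id
    ((continuous_single (A := fun _ : Fin (m + 1) => ℝ) (Fin.last m)).comp (continuous_apply _)))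

/-- Boundedness from above with respect to the dual ordering cone `K`: the set lies in `S - K` for
some bounded set `S`. Outer approximations of the lower image are of this kind. -/
def IsKBounded (D : Set (Fin (m + 1) → ℝ)) : Prop :=
  ∃ S, Bornology.IsBounded S ∧ D ⊆ S - coneK m

lemma IsKBounded.isBounded_inter_le_dotProduct (hD : IsKBounded D) (hg : 0 < g (Fin.last m))
    (γ : ℝ) : Bornology.IsBounded (D ∩ {t | γ ≤ g ⬝ᵥ t}) := by
  obtain ⟨S, hS, hDS⟩ := hD
  obtain ⟨B, hB⟩ : BddAbove ((fun s => g ⬝ᵥ s) '' S) :=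
    ((hS.isCompact_closure.image (continuous_dotProduct_left g)).bddAbove).mono
      (image_mono subset_closure)
  have hseg : Bornology.IsBounded
      (Pi.single (M := fun _ => ℝ) (Fin.last m) '' Icc 0 ((B - γ) / g (Fin.last m))) :=
    (isCompact_Icc.image (continuous_single (Fin.last m))).isBounded
  refine (hS.sub hseg).subset ?_
  rintro t ⟨ht, hγ⟩
  obtain ⟨s, hs, _, ⟨k, hk, rfl⟩, rfl⟩ := hDS ht
  have hγ : γ ≤ g ⬝ᵥ (s - Pi.single (Fin.last m) k) := hγ
  rw [dotProduct_sub, dotProduct_single] at hγ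
  have hsB : g ⬝ᵥ s ≤ B := hB ⟨s, hs, rfl⟩
  exact sub_mem_sub hs ⟨k, ⟨hk, (le_div_iff₀' hg).2 (by linarith)⟩, rfl⟩

lemma IsKBounded.exists_extremePoint_dotProduct_le (hD : IsKBounded D) (hDc : IsClosed D)
    (hg : 0 < g (Fin.last m)) (ht₀ : t₀ ∈ D) : ∃ u ∈ D.extremePoints ℝ, g ⬝ᵥ t₀ ≤ g ⬝ᵥ u :=
  exists_extremePoint_le_of_isCompact (dotProductEquiv ℝ _ g).toContinuousLinearMap ht₀
    (Metric.isCompact_of_isClosed_isBounded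
      (hDc.inter (isClosed_le continuous_const (continuous_dotProduct_left g)))
      (hD.isBounded_inter_le_dotProduct hg _))

lemma IsKBounded.subset_convexHull_extremePoints_sub_coneK (hD : IsKBounded D) (hDc : IsClosed D)
    (hfin : (D.extremePoints ℝ).Finite) : D ⊆ convexHull ℝ (D.extremePoints ℝ) - coneK m := by
  intro t₀ ht₀
  by_contra hnot
  have hconv : Convex ℝ (convexHull ℝ (D.extremePoints ℝ) - coneK m) :=
    (convex_convexHull ℝ _).sub (convex_coneK m)
  have hclosed : IsClosed (convexHull ℝ (D.extremePoints ℝ) - coneK m) := by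
    rw [sub_eq_add_neg]
    exact (isClosed_coneK m).neg.add_left_of_isCompact (hfin.isCompact_convexHull ℝ)
  obtain ⟨w, γ, hwt₀, hw⟩ := exists_dotProduct_lt_of_notMem hconv hclosed hnot
  have hray : ∀ u ∈ D.extremePoints ℝ, ∀ k : ℝ, 0 ≤ k → γ < w ⬝ᵥ u + k * -w (Fin.last m) := by
    intro u hu k hk
    have hlt := hw (u - Pi.single (Fin.last m) k)
      (sub_mem_sub (subset_convexHull ℝ _ hu) ⟨k, hk, rfl⟩)
    rw [dotProduct_sub, dotProduct_single] at hlt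
    linarith
  have hlast : 0 ≤ -w (Fin.last m) := by
    obtain ⟨u, hu, -⟩ := hD.exists_extremePoint_dotProduct_le hDc
      (g := Pi.single (Fin.last m) 1) (by rw [Pi.single_eq_same]; exact zero_lt_one) ht₀
    exact nonneg_of_forall_lt_add_mul (hray u hu)
  -- The separating functional may have a vanishing last coefficient, so it is tilted slightly.
  obtain ⟨B, hB⟩ := (hfin.image fun u => u (Fin.last m)).bddAbove
  obtain ⟨η, hη, hηB⟩ := exists_pos_mul_lt (sub_pos.2 hwt₀) (B - t₀ (Fin.last m))
  obtain ⟨u, hu, hle⟩ := hD.exists_extremePoint_dotProduct_le hDc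
    (g := Pi.single (Fin.last m) η - w) (by rw [Pi.sub_apply, Pi.single_eq_same]; linarith) ht₀
  have hγ := hray u hu 0 le_rfl
  have huB : η * u (Fin.last m) ≤ η * B := mul_le_mul_of_nonneg_left (hB ⟨u, hu, rfl⟩) hη.le
  simp only [sub_dotProduct, single_dotProduct] at hle
  linarith

end KBounded

/-! ### The upper image and the scalar problems -/

namespace CVOP

variable {n m : ℕ} {P : CVOP n m} {v d w : Fin (m + 1) → ℝ} {x : Fin n → ℝ} {z : ℝ}

lemma Assumption.convex_image_add_cone (hP : P.Assumption) :
    Convex ℝ (P.Γ '' P.X + (P.C : Set (Fin (m + 1) → ℝ))) := by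
  rintro _ ⟨_, ⟨x, hx, rfl⟩, k, hk, rfl⟩ _ ⟨_, ⟨y, hy, rfl⟩, l, hl, rfl⟩ a b ha hb hab
  obtain rfl : b = 1 - a := by linarith
  refine ⟨_, ⟨a • x + (1 - a) • y, hP.X_convex hx hy ha hb hab, rfl⟩,
    (a • P.Γ x + (1 - a) • P.Γ y - P.Γ (a • x + (1 - a) • y)) + (a • k + (1 - a) • l),
    P.C.add_mem (hP.Γ_convex x hx y hy a ha (by linarith))
      (P.C.add_mem (P.C.smul_mem ha hk) (P.C.smul_mem hb hl)), ?_⟩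
  simp only [smul_add]
  abel

lemma image_subset_image_add_cone (P : CVOP n m) :
    P.Γ '' P.X ⊆ P.Γ '' P.X + (P.C : Set (Fin (m + 1) → ℝ)) :=
  subset_add_left _ P.C.zero_mem

lemma image_subset_upperImage (P : CVOP n m) : P.Γ '' P.X ⊆ P.upperImage :=
  P.image_subset_image_add_cone.trans subset_closure

lemma cone_subset_recessionCone_image_add_cone (P : CVOP n m) :
    (P.C : Set (Fin (m + 1) → ℝ)) ⊆
      recessionCone (P.Γ '' P.X + (P.C : Set (Fin (m + 1) → ℝ))) := by
  rintro d hd _ ⟨a, ha, k, hk, rfl⟩ α hα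
  exact ⟨a, ha, k + α • d, P.C.add_mem hk (P.C.smul_mem hα hd), (add_assoc _ _ _).symm⟩

lemma cone_subset_recessionCone_upperImage (P : CVOP n m) :
    (P.C : Set (Fin (m + 1) → ℝ)) ⊆ recessionCone P.upperImage :=
  P.cone_subset_recessionCone_image_add_cone.trans (recessionCone_subset_recessionCone_closure _)

lemma exists_P2Feasible_iff :
    (∃ x, P.P2Feasible v d x z) ↔ v + z • d ∈ P.Γ '' P.X + (P.C : Set (Fin (m + 1) → ℝ)) := by
  constructor
  · rintro ⟨x, hx, hC⟩
    exact ⟨_, mem_image_of_mem _ hx, _, hC, add_sub_cancel _ _⟩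
  · rintro ⟨_, ⟨x, hx, rfl⟩, k, hk, hxk⟩
    exact ⟨x, hx, by rw [← hxk, add_sub_cancel_left]; exact hk⟩

lemma le_dotProduct_of_mem_upperImage {γ : ℝ}
    (hw : w ∈ dualCone (P.C : Set (Fin (m + 1) → ℝ))) (h : ∀ x ∈ P.X, γ ≤ w ⬝ᵥ P.Γ x) :
    ∀ y ∈ P.upperImage, γ ≤ w ⬝ᵥ y := by
  refine fun y hy => closure_minimal (t := {y | γ ≤ w ⬝ᵥ y}) ?_
    (isClosed_le continuous_const (continuous_dotProduct_left w)) hy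
  rintro _ ⟨_, ⟨x, hx, rfl⟩, k, hk, rfl⟩
  simp only [mem_ofPred_eq, dotProduct_add]
  linarith [h x hx, hw k hk]

lemma P1Optimal.mem_dualCone_recessionCone (h : P.P1Optimal w x)
    (hw : w ∈ dualCone (P.C : Set (Fin (m + 1) → ℝ))) :
    w ∈ dualCone (recessionCone P.upperImage) :=
  UnboundedCVOP.mem_dualCone_recessionCone
    ⟨_, P.image_subset_upperImage (mem_image_of_mem _ h.1)⟩
    (le_dotProduct_of_mem_upperImage hw h.2)

lemma P1Optimal.isWeakMinimizer (h : P.P1Optimal w x)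
    (hw : w ∈ dualCone (P.C : Set (Fin (m + 1) → ℝ))) (h0 : w ≠ 0) : P.IsWeakMinimizer x := by
  refine ⟨h.1, eq_empty_iff_forall_notMem.2 ?_⟩
  rintro _ ⟨⟨_, rfl, k, hk, rfl⟩, x', hx', hx'k⟩
  have hle : w ⬝ᵥ P.Γ x ≤ w ⬝ᵥ P.Γ x' := h.2 x' hx'
  have hpos : 0 < w ⬝ᵥ k := dotProduct_pos_of_mem_interior hw h0 hk
  rw [hx'k, dotProduct_sub] at hle
  linarith

lemma mem_recessionCone_of_P2Unbounded
    (hconv : Convex ℝ (P.Γ '' P.X + (P.C : Set (Fin (m + 1) → ℝ)))) (h : P.P2Unbounded v d) :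
    d ∈ recessionCone P.upperImage :=
  mem_recessionCone_of_not_bddAbove hconv.closure isClosed_closure fun hbdd =>
    h (hbdd.mono fun _ hz =>
      subset_closure (s := P.Γ '' P.X + (P.C : Set _)) (exists_P2Feasible_iff.1 hz))

/-! ### Strong duality under a Slater condition -/

lemma add_mem_interior_image_add_cone {k : Fin (m + 1) → ℝ} (hx : x ∈ P.X)
    (hk : k ∈ interior (P.C : Set (Fin (m + 1) → ℝ))) :
    P.Γ x + k ∈ interior (P.Γ '' P.X + (P.C : Set (Fin (m + 1) → ℝ))) :=
  subset_interior_add_right (add_mem_add (mem_image_of_mem _ hx) hk)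

lemma P2Optimal.notMem_interior (h : P.P2Optimal v d x z) :
    v + z • d ∉ interior (P.Γ '' P.X + (P.C : Set (Fin (m + 1) → ℝ))) := by
  intro hmem
  obtain ⟨η, hη, hη_mem⟩ := exists_pos_add_smul_mem hmem d
  rw [add_assoc, ← add_smul] at hη_mem
  obtain ⟨x', hx'⟩ := exists_P2Feasible_iff.2 hη_mem
  linarith [h.2 x' (z + η) hx']

lemma P2Optimal.nonneg (h : P.P2Optimal v d x z)
    (hv : v ∈ P.Γ '' P.X + (P.C : Set (Fin (m + 1) → ℝ))) : 0 ≤ z := by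
  obtain ⟨x', hx'⟩ := exists_P2Feasible_iff (d := d) (z := 0).2 (by simpa using hv)
  exact h.2 x' 0 hx'

lemma D2Objective_le_iff :
    P.D2Objective v w ≤ (z : EReal) ↔ ∀ x ∈ P.X, w ⬝ᵥ v - z ≤ w ⬝ᵥ P.Γ x := by
  rw [D2Objective, ← EReal.le_sub_iff_add_le (.inl (EReal.coe_ne_bot _))
    (.inl (EReal.coe_ne_top _)), ← EReal.coe_sub, iSup₂_le_iff]
  refine forall₂_congr fun x _ => ?_
  rw [EReal.coe_le_coe_iff, neg_le, neg_sub]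

lemma P2Optimal.exists_D2Feasible_D2Objective_le
    (hconv : Convex ℝ (P.Γ '' P.X + (P.C : Set (Fin (m + 1) → ℝ))))
    (hv : v ∈ interior (P.Γ '' P.X + (P.C : Set (Fin (m + 1) → ℝ)))) (h : P.P2Optimal v d x z) :
    ∃ w, P.D2Feasible d w ∧ P.D2Objective v w ≤ (z : EReal) := by
  obtain ⟨u, hu0, hu⟩ :=
    exists_dotProduct_le_of_notMem_interior hconv ⟨v, hv⟩ h.notMem_interior
  have huC : u ∈ dualCone (P.C : Set (Fin (m + 1) → ℝ)) :=
    dualCone_anti P.cone_subset_recessionCone_image_add_cone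
      (mem_dualCone_recessionCone ⟨v, interior_subset hv⟩ hu)
  have hud : u ⬝ᵥ d < 0 := by
    have hlt := lt_dotProduct_of_mem_interior hu0 hu hv
    rw [dotProduct_add, dotProduct_smul, smul_eq_mul] at hlt
    exact neg_of_mul_neg_right (by linarith) (h.nonneg (interior_subset hv))
  have hκ : 0 ≤ (-(u ⬝ᵥ d))⁻¹ := (inv_pos.2 (neg_pos.2 hud)).le
  have hwd : ((-(u ⬝ᵥ d))⁻¹ • u) ⬝ᵥ d = -1 := by
    rw [smul_dotProduct, smul_eq_mul, inv_neg, neg_mul, inv_mul_cancel₀ hud.ne]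
  refine ⟨(-(u ⬝ᵥ d))⁻¹ • u, ⟨hwd, smul_mem_dualCone hκ huC⟩,
    D2Objective_le_iff.2 fun x' hx' => ?_⟩
  calc ((-(u ⬝ᵥ d))⁻¹ • u) ⬝ᵥ v - z = ((-(u ⬝ᵥ d))⁻¹ • u) ⬝ᵥ (v + z • d) := by
        rw [dotProduct_add, dotProduct_smul, hwd, smul_eq_mul, mul_neg_one, sub_eq_add_neg]
    _ ≤ ((-(u ⬝ᵥ d))⁻¹ • u) ⬝ᵥ P.Γ x' := by
        rw [smul_dotProduct, smul_dotProduct]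
        exact smul_le_smul_of_nonneg_left
          (hu _ (P.image_subset_image_add_cone (mem_image_of_mem _ hx'))) hκ

lemma P2Feasible.P1Optimal_of_D2Objective_le (hx : P.P2Feasible v d x z) (hw : P.D2Feasible d w)
    (h : P.D2Objective v w ≤ (z : EReal)) : P.P1Optimal w x := by
  refine ⟨hx.1, fun x' hx' => ?_⟩
  have hslack : 0 ≤ w ⬝ᵥ v - z - w ⬝ᵥ P.Γ x := by
    have := hw.2 _ hx.2
    rwa [dotProduct_sub, dotProduct_add, dotProduct_smul, hw.1, smul_eq_mul, mul_neg_one,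
      ← sub_eq_add_neg] at this
  linarith [D2Objective_le_iff.1 h x' hx']

lemma P2Optimal.P1Optimal_of_D2Optimal
    (hconv : Convex ℝ (P.Γ '' P.X + (P.C : Set (Fin (m + 1) → ℝ))))
    (hv : v ∈ interior (P.Γ '' P.X + (P.C : Set (Fin (m + 1) → ℝ))))
    (hx : P.P2Optimal v d x z) (hw : P.D2Optimal v d w) : P.P1Optimal w x := by
  obtain ⟨w', hw', hle⟩ := hx.exists_D2Feasible_D2Objective_le hconv hv
  exact hx.1.P1Optimal_of_D2Objective_le hw.1 ((hw.2 w' hw').trans hle)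

end CVOP

/-! ### Invariants of loops -/

section Loops

variable {α σ : Type} {body : α → σ → σ → Prop} {A : Set α} {s s' : σ}

lemma RunList.invariant {I : σ → Prop} {l : List α} (h : RunList body l s s')
    (hI : ∀ a ∈ l, ∀ s s', I s → body a s s' → I s') (hs : I s) : I s' := by
  induction h with
  | nil => exact hs
  | cons hb _ ih =>
    exact ih (fun a ha => hI a (List.mem_cons_of_mem _ ha)) (hI _ List.mem_cons_self _ _ hs hb)

lemma RunList.forall_mem {Q : α → σ → Prop} {l : List α} (h : RunList body l s s')
    (hnew : ∀ a s s', body a s s' → Q a s')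
    (hstable : ∀ a b s s', Q b s → body a s s' → Q b s') : ∀ a ∈ l, Q a s' := by
  induction h with
  | nil => exact fun _ ha => absurd ha List.not_mem_nil
  | cons hb hr ih =>
    intro b hmem
    rcases List.mem_cons.1 hmem with rfl | hmem
    · exact hr.invariant (I := Q b) (fun a _ s s' => hstable a b s s') (hnew _ _ _ hb)
    · exact ih b hmem

lemma ForEach.invariant {I : σ → Prop} (h : ForEach A body s s')
    (hI : ∀ a ∈ A, ∀ s s', I s → body a s s' → I s') (hs : I s) : I s' := by
  obtain ⟨l, -, hl, hr⟩ := h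
  exact hr.invariant (fun a ha => hI a ((hl a).1 ha)) hs

lemma ForEach.forall_mem {Q : α → σ → Prop} (h : ForEach A body s s')
    (hnew : ∀ a s s', body a s s' → Q a s')
    (hstable : ∀ a b s s', Q b s → body a s s' → Q b s') : ∀ a ∈ A, Q a s' := by
  obtain ⟨l, -, hl, hr⟩ := h
  exact fun a ha => hr.forall_mem hnew hstable a ((hl a).2 ha)

lemma ForEach.finite (h : ForEach A body s s') : A.Finite := by
  obtain ⟨l, -, hl, -⟩ := h
  exact (List.finite_toSet l).subset fun a ha => (hl a).2 ha

lemma While.invariant {cond : σ → Prop} {body : σ → σ → Prop} {I : σ → Prop}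
    (h : While cond body s s') (hI : ∀ s s', I s → body s s' → I s') (hs : I s) : I s' := by
  obtain ⟨h, -⟩ := h
  induction h with
  | refl => exact hs
  | tail _ hb ih => exact hI _ _ ih hb.2

end Loops

/-! ### Outer approximations of the recession cone -/

section OuterApproximation

variable {n m : ℕ} {P : CVOP n m} {δ : ℝ} {F : Set ((Fin n → ℝ) × (Fin (m + 1) → ℝ))}
  {x : Fin n → ℝ} {w : Fin (m + 1) → ℝ}

lemma exists_l1norm_sub_le_of_mem_convexHull {q : ℕ} {A S : Set (Fin q → ℝ)}
    (hA : Convex ℝ A) (hS : ∀ y ∈ S, ∃ r ∈ A, l1norm (y - r) ≤ δ) {y : Fin q → ℝ}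
    (hy : y ∈ convexHull ℝ S) : ∃ r ∈ A, l1norm (y - r) ≤ δ := by
  have hball : Convex ℝ {z : Fin q → ℝ | l1norm z ≤ δ} := by
    simpa using convexOn_l1norm.convex_le δ
  have hsub : convexHull ℝ S ⊆ A + {z | l1norm z ≤ δ} := by
    refine convexHull_min (fun y hy => ?_) (hA.add hball)
    obtain ⟨r, hr, hle⟩ := hS y hy
    exact ⟨r, hr, y - r, hle, add_sub_cancel _ _⟩
  obtain ⟨r, hr, z, hz, rfl⟩ := hsub hy
  exact ⟨r, hr, by simpa using hz⟩

lemma isOuterApprox_of_forall_exists {Y : Set (Fin (m + 1) → ℝ)} (hδ : 0 ≤ δ)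
    (hsub : recessionCone P.upperImage ⊆ cone Y)
    (hnear : ∀ y ∈ cone Y ∩ l1Ball (m + 1),
      ∃ r ∈ recessionCone P.upperImage ∩ l1Ball (m + 1), l1norm (y - r) ≤ δ) :
    P.IsOuterApprox δ Y :=
  ⟨hsub, l1Hausdorff_le_of_forall_exists
    (fun y hy => ⟨y, ⟨hsub hy.1, hy.2⟩, by rwa [sub_self, l1norm_zero]⟩) hnear⟩

/-- A finite set of pairs `(x, w)` such that `x` minimizes the weighted sum with nonzero weight
`w ∈ C⁺`, so that each pair supports the upper image by a halfspace. These are the pairs with which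
the initialization algorithm cuts. -/
structure IsSupportFamily (P : CVOP n m) (F : Set ((Fin n → ℝ) × (Fin (m + 1) → ℝ))) : Prop where
  finite : F.Finite
  optimal : ∀ f ∈ F, P.P1Optimal f.2 f.1
  mem_dualCone : ∀ f ∈ F, f.2 ∈ dualCone (P.C : Set (Fin (m + 1) → ℝ))
  ne_zero : ∀ f ∈ F, f.2 ≠ 0

/-- The intersection of the halfspaces given by the pairs `(x, w)` in `F`. -/
def supportPolyhedron (P : CVOP n m) (F : Set ((Fin n → ℝ) × (Fin (m + 1) → ℝ))) :
    Set (Fin (m + 1) → ℝ) :=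
  {y | ∀ f ∈ F, 0 ≤ f.2 ⬝ᵥ (y - P.Γ f.1)}

lemma isSupportFamily_empty (P : CVOP n m) : IsSupportFamily P ∅ where
  finite := finite_empty
  optimal := forall_mem_empty.2 trivial
  mem_dualCone := forall_mem_empty.2 trivial
  ne_zero := forall_mem_empty.2 trivial

lemma IsSupportFamily.insert (hF : IsSupportFamily P F) (hx : P.P1Optimal w x)
    (hw : w ∈ dualCone (P.C : Set (Fin (m + 1) → ℝ))) (h0 : w ≠ 0) :
    IsSupportFamily P (insert (x, w) F) where
  finite := hF.finite.insert _
  optimal := forall_mem_insert.2 ⟨hx, hF.optimal⟩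
  mem_dualCone := forall_mem_insert.2 ⟨hw, hF.mem_dualCone⟩
  ne_zero := forall_mem_insert.2 ⟨h0, hF.ne_zero⟩

lemma supportPolyhedron_empty (P : CVOP n m) : supportPolyhedron P ∅ = univ := by
  simp [supportPolyhedron]

lemma supportPolyhedron_insert (P : CVOP n m) (F : Set ((Fin n → ℝ) × (Fin (m + 1) → ℝ)))
    (x : Fin n → ℝ) (w : Fin (m + 1) → ℝ) :
    supportPolyhedron P (insert (x, w) F) =
      supportPolyhedron P F ∩ {y | 0 ≤ w ⬝ᵥ (y - P.Γ x)} := by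
  ext y
  simp only [supportPolyhedron, mem_inter_iff, mem_ofPred_eq, forall_mem_insert, and_comm]

lemma IsSupportFamily.image_subset_supportPolyhedron (hF : IsSupportFamily P F) :
    P.Γ '' P.X ⊆ supportPolyhedron P F := by
  rintro _ ⟨x, hx, rfl⟩ f hf
  rw [dotProduct_sub, sub_nonneg]
  exact (hF.optimal f hf).2 x hx

lemma IsSupportFamily.recessionCone_supportPolyhedron (hF : IsSupportFamily P F)
    (hX : P.X.Nonempty) : recessionCone (supportPolyhedron P F) = dualCone (Prod.snd '' F) := by
  refine Subset.antisymm ?_ fun d hd y hy α hα f hf => ?_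
  · rintro d hd _ ⟨f, hf, rfl⟩
    rw [dotProduct_comm]
    refine mem_dualCone_recessionCone (γ := f.2 ⬝ᵥ P.Γ f.1)
      ((hX.image P.Γ).mono hF.image_subset_supportPolyhedron) (fun y hy => ?_) d hd
    simpa only [dotProduct_sub, sub_nonneg] using hy f hf
  · have hfd : 0 ≤ f.2 ⬝ᵥ d := dotProduct_comm d f.2 ▸ hd f.2 (mem_image_of_mem _ hf)
    rw [add_sub_right_comm, dotProduct_add, dotProduct_smul]
    exact add_nonneg (hy f hf) (mul_nonneg hα hfd)

lemma IsSupportFamily.recessionCone_upperImage_subset (hF : IsSupportFamily P F) :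
    recessionCone P.upperImage ⊆ dualCone (Prod.snd '' F) := by
  rintro d hd _ ⟨f, hf, rfl⟩
  rw [dotProduct_comm]
  exact (hF.optimal f hf).mem_dualCone_recessionCone (hF.mem_dualCone f hf) d hd

lemma IsSupportFamily.isOuterApprox_outerDirections (hF : IsSupportFamily P F)
    (hX : P.X.Nonempty) (hδ : 0 ≤ δ)
    (hnear : ∀ d ∈ outerDirections (supportPolyhedron P F),
      ∃ r ∈ recessionCone P.upperImage ∩ l1Ball (m + 1), l1norm (d - r) ≤ δ) :
    P.IsOuterApprox δ (outerDirections (supportPolyhedron P F)) := by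
  have hW : (Prod.snd '' F).Finite := hF.finite.image _
  have hrec := hF.recessionCone_supportPolyhedron hX
  have hcone := cone_outerDirections_of_recessionCone_eq hW hrec
  refine isOuterApprox_of_forall_exists hδ
    (hF.recessionCone_upperImage_subset.trans hcone.ge) fun y hy => ?_
  rw [hcone, ← convexHull_extremePoints_dualCone_inter_l1Ball hW, ← hrec] at hy
  refine exists_l1norm_sub_le_of_mem_convexHull (convex_recessionCone.inter convex_l1Ball)
    (fun d hd => ?_) hy
  by_cases h0 : d = 0
  · exact ⟨0, ⟨zero_mem_recessionCone, l1norm_zero.le.trans zero_le_one⟩,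
      by rwa [h0, sub_zero, l1norm_zero]⟩
  · exact hnear d ⟨hd, h0⟩

end OuterApproximation

/-! ### The initialization algorithm -/

section Initialization

variable {n m : ℕ} {P : CVOP n m} {p : Params m} {δ : ℝ}
  {F : Set ((Fin n → ℝ) × (Fin (m + 1) → ℝ))} {s s' : InitState n m}
  {d v w : Fin (m + 1) → ℝ} {x : Fin n → ℝ}

lemma Params.Admissible.R_subset (hp : p.Admissible P) :
    (p.R : Set (Fin (m + 1) → ℝ)) ⊆ P.C :=
  hp.R_generates ▸ subset_cone _

lemma Params.Admissible.Rstar_subset (hp : p.Admissible P) :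
    (p.Rstar : Set (Fin (m + 1) → ℝ)) ⊆ dualCone (P.C : Set (Fin (m + 1) → ℝ)) :=
  hp.Rstar_generates ▸ subset_cone _

lemma Params.Admissible.sum_mem_interior (hp : p.Admissible P) :
    ∑ d ∈ p.R, d ∈ interior (P.C : Set (Fin (m + 1) → ℝ)) := by
  rw [← hp.R_generates]
  exact sum_mem_interior_cone ⟨p.c, hp.R_generates.symm ▸ hp.c_mem⟩

lemma Params.Admissible.dualCone_Rstar (hp : p.Admissible P)
    (hC : IsClosed (P.C : Set (Fin (m + 1) → ℝ))) :
    dualCone (p.Rstar : Set (Fin (m + 1) → ℝ)) = P.C := by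
  rw [← dualCone_cone, hp.Rstar_generates, dualCone_dualCone hC]

lemma Params.Admissible.recessionCone_upperImage_eq_univ (hp : p.Admissible P)
    (hR : -(p.R : Set (Fin (m + 1) → ℝ)) ⊆ recessionCone P.upperImage) :
    recessionCone P.upperImage = univ := by
  refine recessionCone_eq_univ_of_neg_subset ⟨p.c, hp.c_mem⟩
    P.cone_subset_recessionCone_upperImage ?_
  rw [← neg_subset_neg, neg_neg, ← recessionCone_neg, ← hp.R_generates]
  refine cone_subset_recessionCone ?_
  rwa [recessionCone_neg, ← neg_subset_neg, neg_neg]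

/-- The dual point `Tᵀ (w / cᵀw)` stored when cutting with a weight `w`. -/
noncomputable def dualPoint (p : Params m) (w : Fin (m + 1) → ℝ) : Fin (m + 1) → ℝ :=
  p.Tᵀ *ᵥ ((p.c ⬝ᵥ w)⁻¹ • w)

/-- The state of the initialization algorithm after cutting with the pairs in `F`, while inner
directions are unit recession directions and the directions in `Chat` are `δ`-close to them. -/
structure InitInvariant (P : CVOP n m) (p : Params m) (δ : ℝ)
    (F : Set ((Fin n → ℝ) × (Fin (m + 1) → ℝ))) (s : InitState n m) : Prop where
  isSupportFamily : IsSupportFamily P F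
  P0_eq : s.P0 = supportPolyhedron P F
  Xbar_eq : s.Xbar = Prod.fst '' F
  Tbar_eq : s.Tbar = (fun f => dualPoint p f.2) '' F
  YIn_subset : s.YIn ⊆ recessionCone P.upperImage
  YIn_norm : ∀ r ∈ s.YIn, l1norm r = 1
  Chat_near : ∀ d ∈ s.Chat, ∃ r ∈ s.YIn, l1norm (d - r) ≤ δ

lemma initInvariant_initStart (hp : p.Admissible P) (δ : ℝ) :
    InitInvariant P p δ ∅ (initStart p) where
  isSupportFamily := isSupportFamily_empty P
  P0_eq := (supportPolyhedron_empty P).symm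
  Xbar_eq := (image_empty _).symm
  Tbar_eq := (image_empty _).symm
  YIn_subset := hp.R_subset.trans P.cone_subset_recessionCone_upperImage
  YIn_norm := hp.R_norm
  Chat_near := forall_mem_empty.2 trivial

lemma InitInvariant.cut (h : InitInvariant P p δ F s) (hx : P.P1Optimal w x)
    (hw : w ∈ dualCone (P.C : Set (Fin (m + 1) → ℝ))) (h0 : w ≠ 0) :
    InitInvariant P p δ (insert (x, w) F) (s.cut P p x w) where
  isSupportFamily := h.isSupportFamily.insert hx hw h0
  P0_eq := by rw [InitState.cut, h.P0_eq, supportPolyhedron_insert]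
  Xbar_eq := by rw [InitState.cut, h.Xbar_eq, image_insert_eq]
  Tbar_eq := by rw [InitState.cut, h.Tbar_eq, image_insert_eq, dualPoint]
  YIn_subset := h.YIn_subset
  YIn_norm := h.YIn_norm
  Chat_near := h.Chat_near

lemma InitInvariant.insert_YIn (h : InitInvariant P p δ F s)
    (hd : d ∈ recessionCone P.upperImage) (hd1 : l1norm d = 1) :
    InitInvariant P p δ F { s with YIn := insert d s.YIn } :=
  { h with
    YIn_subset := insert_subset hd h.YIn_subset
    YIn_norm := forall_mem_insert.2 ⟨hd1, h.YIn_norm⟩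
    Chat_near := fun e he => (h.Chat_near e he).imp fun _ hr => hr.imp_left (mem_insert_of_mem _) }

lemma InitInvariant.cut_of_P2Optimal_of_D2Optimal (h : InitInvariant P p δ F s)
    (hconv : Convex ℝ (P.Γ '' P.X + (P.C : Set (Fin (m + 1) → ℝ))))
    (hv : v ∈ interior (P.Γ '' P.X + (P.C : Set (Fin (m + 1) → ℝ)))) {z : ℝ}
    (hx : P.P2Optimal v d x z) (hw : P.D2Optimal v d w) :
    InitInvariant P p δ (insert (x, w) F) (s.cut P p x w) := by
  refine h.cut (hx.P1Optimal_of_D2Optimal hconv hv hw) hw.1.2 ?_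
  rintro rfl
  simpa using hw.1.1

lemma exists_initInvariant_of_checkBounded (hp : p.Admissible P) (hw : w ∈ p.Rstar)
    (h : ∃ F, InitInvariant P p δ F s) (hs : checkBounded P p w s s') :
    ∃ F, InitInvariant P p δ F s' := by
  obtain ⟨F, hF⟩ := h
  rcases hs with ⟨-, rfl⟩ | ⟨x, hx, rfl⟩
  · exact ⟨F, { hF with }⟩
  · refine ⟨_, hF.cut hx (hp.Rstar_subset hw) ?_⟩
    rintro rfl
    simpa using hp.Rstar_norm 0 hw

lemma exists_initInvariant_of_checkLineality (hp : p.Admissible P)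
    (hconv : Convex ℝ (P.Γ '' P.X + (P.C : Set (Fin (m + 1) → ℝ))))
    (hv : v ∈ interior (P.Γ '' P.X + (P.C : Set (Fin (m + 1) → ℝ))))
    (hd : d ∈ -(p.R : Set (Fin (m + 1) → ℝ))) (h : ∃ F, InitInvariant P p δ F s)
    (hs : checkLineality P p v d s s') : ∃ F, InitInvariant P p δ F s' := by
  obtain ⟨F, hF⟩ := h
  rcases hs with ⟨hunb, rfl⟩ | ⟨x, z, w, hx, hw, rfl⟩
  · refine ⟨F, hF.insert_YIn (CVOP.mem_recessionCone_of_P2Unbounded hconv hunb) ?_⟩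
    rw [← l1norm_neg]
    exact hp.R_norm _ hd
  · exact ⟨_, hF.cut_of_P2Optimal_of_D2Optimal hconv hv hx hw⟩

lemma exists_P1Optimal_of_forEach_checkBounded {A : Set (Fin (m + 1) → ℝ)}
    (h : ForEach A (checkBounded P p) s s') (hb : s'.b = true) :
    ∀ z ∈ A, ∃ x ∈ s'.Xbar, P.P1Optimal z x := by
  refine fun z hz => h.forall_mem
    (Q := fun z s => s.b = true → ∃ x ∈ s.Xbar, P.P1Optimal z x) ?_ ?_ z hz hb
  · rintro z s s' (⟨-, rfl⟩ | ⟨x, hx, rfl⟩) hb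
    · exact absurd hb Bool.false_ne_true
    · exact ⟨x, mem_insert _ _, hx⟩
  · rintro z z' s s' hQ (⟨-, rfl⟩ | ⟨x, -, rfl⟩) hb
    · exact absurd hb Bool.false_ne_true
    · exact (hQ hb).imp fun _ hx' => hx'.imp_left (mem_insert_of_mem _)

lemma subset_YIn_or_nonempty_of_forEach_checkLineality {A : Set (Fin (m + 1) → ℝ)}
    (h : ForEach A (checkLineality P p v) s s') : A ⊆ s'.YIn ∨ s'.Xbar.Nonempty := by
  refine or_iff_not_imp_right.2 fun hX d hd => (h.forall_mem
    (Q := fun d s => d ∈ s.YIn ∨ s.Xbar.Nonempty) ?_ ?_ d hd).resolve_right hX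
  · rintro d s s' (⟨-, rfl⟩ | ⟨x, z, w, -, -, rfl⟩)
    · exact .inl (mem_insert _ _)
    · exact .inr ⟨x, mem_insert _ _⟩
  · rintro d d' s s' hQ (⟨-, rfl⟩ | ⟨x, z, w, -, -, rfl⟩)
    · exact hQ.imp_left (mem_insert_of_mem _)
    · exact .inr ⟨x, mem_insert _ _⟩

/-- The invariant of the iteration phase: in addition to `InitInvariant`, the outer directions are
up to date, and a halfspace has been cut off unless all of `-R` consists of inner directions. -/
structure IterationInvariant (P : CVOP n m) (p : Params m) (δ : ℝ) (s : InitState n m) : Prop where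
  exists_initInvariant : ∃ F, InitInvariant P p δ F s
  YOut_eq : s.YOut = outerDirections s.P0
  subset_or_nonempty : -(p.R : Set (Fin (m + 1) → ℝ)) ⊆ s.YIn ∨ s.Xbar.Nonempty

lemma IterationInvariant.of_initBody (h : IterationInvariant P p δ s)
    (hconv : Convex ℝ (P.Γ '' P.X + (P.C : Set (Fin (m + 1) → ℝ))))
    (hv : v ∈ interior (P.Γ '' P.X + (P.C : Set (Fin (m + 1) → ℝ))))
    (hs : initBody P p δ v s s') : IterationInvariant P p δ s' := by
  obtain ⟨⟨F, hF⟩, hY, hR⟩ := h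
  obtain ⟨d, -, r, hr, -, ⟨hle, rfl⟩ | ⟨-, lam, -, -, e, -, he,
    ⟨hunb, rfl⟩ | ⟨x, z, w, hx, hw, rfl⟩⟩⟩ := hs
  · exact ⟨⟨F, { hF with Chat_near := forall_mem_insert.2 ⟨⟨r, hr, hle⟩, hF.Chat_near⟩ }⟩, hY, hR⟩
  · have he_mem := smul_mem_recessionCone (inv_nonneg.2 (l1norm_pos he).le)
      (CVOP.mem_recessionCone_of_P2Unbounded hconv hunb)
    exact ⟨⟨F, hF.insert_YIn he_mem (l1norm_inv_smul_self he)⟩, hY,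
      hR.imp_left fun h => h.trans (subset_insert _ _)⟩
  · have hcut := hF.cut_of_P2Optimal_of_D2Optimal hconv hv hx hw
    exact ⟨⟨_, { hcut with }⟩, rfl, .inr ⟨x, mem_insert _ _⟩⟩

/-- The properties of the output of the initialization algorithm on which the correctness of the
dual algorithm rests, where `F` is the family of pairs with which the algorithm has cut. -/
structure InitGuarantee (P : CVOP n m) (p : Params m) (δ : ℝ)
    (F : Set ((Fin n → ℝ) × (Fin (m + 1) → ℝ))) (s : InitState n m) : Prop where
  isSupportFamily : IsSupportFamily P F
  Xbar_eq : s.Xbar = Prod.fst '' F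
  Tbar_eq : s.Tbar = (fun f => dualPoint p f.2) '' F
  finite_YOut : s.YOut.Finite
  isOuterApprox : P.IsOuterApprox δ s.YOut
  isClosed_cone : IsClosed (cone s.YOut)
  mem_dualCone_YOut : ∀ f ∈ F, f.2 ∈ dualCone (cone s.YOut)
  recessionCone_eq_univ : F = ∅ → recessionCone P.upperImage = univ

lemma InitInvariant.guarantee_of_forall_P1Optimal (h : InitInvariant P p δ F s)
    (hp : p.Admissible P) (hC : IsClosed (P.C : Set (Fin (m + 1) → ℝ))) (hδ : 0 ≤ δ)
    (hopt : ∀ z ∈ p.Rstar, ∃ x ∈ s.Xbar, P.P1Optimal z x) :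
    InitGuarantee P p δ F { s with YOut := p.R } where
  isSupportFamily := h.isSupportFamily
  Xbar_eq := h.Xbar_eq
  Tbar_eq := h.Tbar_eq
  finite_YOut := p.R.finite_toSet
  isOuterApprox := by
    refine isOuterApprox_of_forall_exists hδ (fun d hd => ?_) fun y hy =>
      ⟨y, ⟨P.cone_subset_recessionCone_upperImage (hp.R_generates.le hy.1), hy.2⟩,
        by rwa [sub_self, l1norm_zero]⟩
    rw [hp.R_generates, ← hp.dualCone_Rstar hC]
    intro z hz
    obtain ⟨x, -, hx⟩ := hopt z hz
    rw [dotProduct_comm]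
    exact hx.mem_dualCone_recessionCone (hp.Rstar_subset hz) d hd
  isClosed_cone := hp.R_generates ▸ hC
  mem_dualCone_YOut := hp.R_generates ▸ h.isSupportFamily.mem_dualCone
  recessionCone_eq_univ := by
    rintro rfl
    have hRstar : (p.Rstar : Set (Fin (m + 1) → ℝ)) = ∅ := by
      refine eq_empty_iff_forall_notMem.2 fun z hz => ?_
      obtain ⟨x, hx, -⟩ := hopt z hz
      simp [h.Xbar_eq] at hx
    have hCuniv : (P.C : Set (Fin (m + 1) → ℝ)) = univ := by
      rw [← hp.dualCone_Rstar hC, hRstar]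
      simp [dualCone]
    exact univ_subset_iff.1 (hCuniv ▸ P.cone_subset_recessionCone_upperImage)

lemma InitInvariant.exists_l1norm_sub_le (h : InitInvariant P p δ F s) (hδ : 0 ≤ δ)
    (hterm : ¬ initCond s) : ∀ d ∈ s.YOut,
      ∃ r ∈ recessionCone P.upperImage ∩ l1Ball (m + 1), l1norm (d - r) ≤ δ := by
  have hYsub : s.YOut ⊆ s.YIn ∪ s.Chat := by
    rwa [initCond, not_nonempty_iff_eq_empty, sdiff_eq_empty] at hterm
  have hin : s.YIn ⊆ recessionCone P.upperImage ∩ l1Ball (m + 1) := fun r hr =>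
    ⟨h.YIn_subset hr, (h.YIn_norm r hr).le⟩
  intro d hd
  rcases hYsub hd with hd | hd
  · exact ⟨d, hin hd, by rwa [sub_self, l1norm_zero]⟩
  · exact (h.Chat_near d hd).imp fun r hr => hr.imp_left (@hin r)

lemma IterationInvariant.exists_guarantee (h : IterationInvariant P p δ s) (hp : p.Admissible P)
    (hX : P.X.Nonempty) (hδ : 0 ≤ δ) (hterm : ¬ initCond s) : ∃ F, InitGuarantee P p δ F s := by
  obtain ⟨⟨F, hF⟩, hY, hR⟩ := h
  rw [hF.P0_eq] at hY
  have hW : (Prod.snd '' F).Finite := hF.isSupportFamily.finite.image _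
  have hrec := hF.isSupportFamily.recessionCone_supportPolyhedron hX
  have hcone : cone s.YOut = dualCone (Prod.snd '' F) :=
    hY ▸ cone_outerDirections_of_recessionCone_eq hW hrec
  have hnear := hF.exists_l1norm_sub_le hδ hterm
  refine ⟨F, hF.isSupportFamily, hF.Xbar_eq, hF.Tbar_eq, ?_, ?_, hcone ▸ isClosed_dualCone _,
    ?_, ?_⟩
  · rw [hY, outerDirections, hrec]
    exact (finite_extremePoints_dualCone_inter_l1Ball hW).sdiff
  · rw [hY] at hnear ⊢
    exact hF.isSupportFamily.isOuterApprox_outerDirections hX hδ hnear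
  · intro f hf d hd
    rw [dotProduct_comm]
    exact (hcone ▸ hd) f.2 (mem_image_of_mem _ hf)
  · rintro rfl
    have hXbar : ¬ s.Xbar.Nonempty := by simp [hF.Xbar_eq]
    exact hp.recessionCone_upperImage_eq_univ ((hR.resolve_right hXbar).trans hF.YIn_subset)

theorem InitRun.exists_guarantee (h : InitRun P p δ s) (hp : p.Admissible P)
    (hconv : Convex ℝ (P.Γ '' P.X + (P.C : Set (Fin (m + 1) → ℝ))))
    (hC : IsClosed (P.C : Set (Fin (m + 1) → ℝ))) (hδ : 0 ≤ δ) :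
    ∃ F, InitGuarantee P p δ F s := by
  obtain ⟨x₀, hx₀, s₁, hbounded, hcases⟩ := h
  have hv := CVOP.add_mem_interior_image_add_cone hx₀ hp.sum_mem_interior
  have hs₁ : ∃ F, InitInvariant P p δ F s₁ := hbounded.invariant
    (fun _ hw _ _ => exists_initInvariant_of_checkBounded hp hw)
    ⟨∅, initInvariant_initStart hp δ⟩
  rcases hcases with ⟨hb, rfl⟩ | ⟨-, s₂, hlineality, hwhile⟩
  · obtain ⟨F, hF⟩ := hs₁
    exact ⟨F, hF.guarantee_of_forall_P1Optimal hp hC hδ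
      (exists_P1Optimal_of_forEach_checkBounded hbounded hb)⟩
  · obtain ⟨F, hF⟩ := hlineality.invariant
      (fun _ hd _ _ => exists_initInvariant_of_checkLineality hp hconv hv hd) hs₁
    have hR := subset_YIn_or_nonempty_of_forEach_checkLineality hlineality
    have hstart : IterationInvariant P p δ s₂.recomputeYOut := ⟨⟨F, { hF with }⟩, rfl, hR⟩
    exact (hwhile.invariant (fun _ _ h => h.of_initBody hconv hv) hstart).exists_guarantee hp
      ⟨x₀, hx₀⟩ hδ hwhile.2

end Initialization

/-! ### The geometric dual problem -/

section DualObjective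

variable {n m : ℕ} {P : CVOP n m} {p : Params m} {T : Matrix (Fin (m + 1)) (Fin (m + 1)) ℝ}
  {A : Set (Fin (m + 1) → ℝ)} {t w : Fin (m + 1) → ℝ} {x : Fin n → ℝ}

lemma wOf_update_last (T : Matrix (Fin (m + 1)) (Fin (m + 1)) ℝ) (t : Fin (m + 1) → ℝ) (r : ℝ) :
    wOf T (Function.update t (Fin.last m) r) = wOf T t := by
  rw [wOf, wOf, Function.update_idem]

lemma sub_single_last (t : Fin (m + 1) → ℝ) (k : ℝ) :
    t - Pi.single (Fin.last m) k = Function.update t (Fin.last m) (t (Fin.last m) - k) := by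
  ext i
  rcases eq_or_ne i (Fin.last m) with rfl | hi
  · simp
  · simp [hi]

lemma wOf_smul_add_smul (T : Matrix (Fin (m + 1)) (Fin (m + 1)) ℝ) (t u : Fin (m + 1) → ℝ)
    {a b : ℝ} (hab : a + b = 1) : wOf T (a • t + b • u) = a • wOf T t + b • wOf T u := by
  simp only [wOf, ← Matrix.smul_vecMul, ← Matrix.add_vecMul, ← Function.update_smul,
    ← Function.update_add, smul_eq_mul, mul_one, hab]

lemma continuous_wOf (T : Matrix (Fin (m + 1)) (Fin (m + 1)) ℝ) : Continuous (wOf T) :=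
  (continuous_id.update _ continuous_const).matrix_vecMul continuous_const

lemma continuous_wOf_dotProduct (T : Matrix (Fin (m + 1)) (Fin (m + 1)) ℝ)
    (y : Fin (m + 1) → ℝ) : Continuous fun t => wOf T t ⬝ᵥ y :=
  (continuous_wOf T).dotProduct continuous_const

lemma convex_setOf_last_sub_le (T : Matrix (Fin (m + 1)) (Fin (m + 1)) ℝ) (y : Fin (m + 1) → ℝ)
    (ε : ℝ) : Convex ℝ {t : Fin (m + 1) → ℝ | t (Fin.last m) - ε ≤ wOf T t ⬝ᵥ y} := by
  intro t ht u hu a b ha hb hab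
  have hcomb := add_le_add (mul_le_mul_of_nonneg_left ht.out ha)
    (mul_le_mul_of_nonneg_left hu.out hb)
  rw [mem_ofPred_eq, wOf_smul_add_smul _ _ _ hab, add_dotProduct, smul_dotProduct,
    smul_dotProduct]
  simp only [Pi.add_apply, Pi.smul_apply, smul_eq_mul]
  linear_combination hcomb + ε * hab

lemma setOf_last_le_ne_univ (T : Matrix (Fin (m + 1)) (Fin (m + 1)) ℝ) (y : Fin (m + 1) → ℝ) :
    {t : Fin (m + 1) → ℝ | t (Fin.last m) ≤ wOf T t ⬝ᵥ y} ≠ univ := by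
  refine (ne_univ_iff_exists_notMem _).2
    ⟨Function.update 0 (Fin.last m) (wOf T 0 ⬝ᵥ y + 1), fun h => ?_⟩
  rw [mem_ofPred_eq, wOf_update_last, Function.update_self] at h
  linarith

lemma Params.Admissible.transpose_mulVec_last (hp : p.Admissible P) (w : Fin (m + 1) → ℝ) :
    (p.Tᵀ *ᵥ w) (Fin.last m) = w ⬝ᵥ p.c := by
  rw [dotProduct_comm, ← show (fun i => p.T i (Fin.last m)) = p.c from funext hp.T_last_column]
  rfl

lemma Params.Admissible.transpose_mulVec_wOf (hp : p.Admissible P) (t : Fin (m + 1) → ℝ) :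
    p.Tᵀ *ᵥ wOf p.T t = Function.update t (Fin.last m) 1 := by
  rw [Matrix.mulVec_transpose, wOf, Matrix.vecMul_vecMul, Matrix.nonsing_inv_mul _ hp.T_nonsingular,
    Matrix.vecMul_one]

lemma Params.Admissible.wOf_dotProduct_c (hp : p.Admissible P) (t : Fin (m + 1) → ℝ) :
    wOf p.T t ⬝ᵥ p.c = 1 := by
  rw [← hp.transpose_mulVec_last, hp.transpose_mulVec_wOf, Function.update_self]

lemma Params.Admissible.wOf_ne_zero (hp : p.Admissible P) (t : Fin (m + 1) → ℝ) :
    wOf p.T t ≠ 0 := fun h => by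
  simpa [h] using hp.wOf_dotProduct_c t

lemma Params.Admissible.wOf_transpose_mulVec (hp : p.Admissible P) (hw : w ⬝ᵥ p.c = 1) :
    wOf p.T (p.Tᵀ *ᵥ w) = w := by
  have hlast : Function.update (p.Tᵀ *ᵥ w) (Fin.last m) 1 = p.Tᵀ *ᵥ w := by
    rw [← hw, ← hp.transpose_mulVec_last, Function.update_eq_self]
  rw [wOf, hlast, Matrix.mulVec_transpose, Matrix.vecMul_vecMul,
    Matrix.mul_nonsing_inv _ hp.T_nonsingular, Matrix.vecMul_one]

lemma Params.Admissible.wOf_dualPoint (hp : p.Admissible P) (hw : w ⬝ᵥ p.c ≠ 0) :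
    wOf p.T (dualPoint p w) = (w ⬝ᵥ p.c)⁻¹ • w := by
  rw [dualPoint, dotProduct_comm p.c]
  exact hp.wOf_transpose_mulVec (by rw [smul_dotProduct, smul_eq_mul, inv_mul_cancel₀ hw])

lemma shift_toExt_update_last (t : Fin (m + 1) → ℝ) (r k : ℝ) :
    shift (toExt (Function.update t (Fin.last m) r)) k =
      toExt (Function.update t (Fin.last m) (r + k)) := by
  simp [toExt, shift]

lemma dualObjective_update_last (P : CVOP n m) (T : Matrix (Fin (m + 1)) (Fin (m + 1)) ℝ)
    (t : Fin (m + 1) → ℝ) (r : ℝ) :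
    dualObjective P T (Function.update t (Fin.last m) r) = dualObjective P T t := by
  simp [dualObjective, wOf_update_last]

lemma CVOP.P1Optimal.dualObjective_eq (h : P.P1Optimal (wOf T t) x) :
    dualObjective P T t = toExt (Function.update t (Fin.last m) (wOf T t ⬝ᵥ P.Γ x)) := by
  simp only [toExt, Fin.init_update_last, Function.update_self]
  exact Prod.ext rfl (le_antisymm (iInf₂_le x h.1)
    (le_iInf₂ fun x' hx' => EReal.coe_le_coe_iff.2 (h.2 x' hx')))

lemma exists_dualObjective_eq_toExt (hX : P.X.Nonempty) {γ : ℝ}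
    (hγ : ∀ x ∈ P.X, γ ≤ wOf T t ⬝ᵥ P.Γ x) :
    ∃ r : ℝ, dualObjective P T t = toExt (Function.update t (Fin.last m) r) ∧
      ∀ x ∈ P.X, r ≤ wOf T t ⬝ᵥ P.Γ x := by
  obtain ⟨x₀, hx₀⟩ := hX
  obtain ⟨r, hr⟩ : ∃ r : ℝ, (⨅ x ∈ P.X, ((wOf T t ⬝ᵥ P.Γ x : ℝ) : EReal)) = (r : EReal) :=
    ⟨_, (EReal.coe_toReal (ne_top_of_le_ne_top (EReal.coe_ne_top _) (iInf₂_le x₀ hx₀))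
      (ne_bot_of_le_ne_bot (EReal.coe_ne_bot γ)
        (le_iInf₂ fun x hx => EReal.coe_le_coe_iff.2 (hγ x hx)))).symm⟩
  refine ⟨r, by simp [dualObjective, toExt, hr], fun x hx => ?_⟩
  rw [← EReal.coe_le_coe_iff, ← hr]
  exact iInf₂_le x hx

lemma CVOP.P1Optimal.isDualMaximizer (h : P.P1Optimal (wOf T t) x) (ht : wOf T t ∈ dualCone A) :
    IsDualMaximizer P T A t := by
  refine ⟨ht, ?_⟩
  rintro k hk ⟨t', -, heq⟩
  have hinit : (Fin.init t' : Fin m → ℝ) = Fin.init t := congrArg Prod.fst heq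
  have hsame : dualObjective P T t' = dualObjective P T t := by
    rw [← dualObjective_update_last P T t' (t (Fin.last m)), ← Fin.snoc_init_self t', hinit,
      Fin.update_snoc_last, Fin.snoc_init_self]
  rw [hsame, h.dualObjective_eq, shift_toExt_update_last] at heq
  have hlast : wOf T t ⬝ᵥ P.Γ x = wOf T t ⬝ᵥ P.Γ x + k := by
    simpa only [toExt, Function.update_self, EReal.coe_eq_coe_iff] using congrArg Prod.snd heq
  linarith

lemma CVOP.P1Optimal.smul {k : ℝ} (h : P.P1Optimal w x) (hk : 0 ≤ k) :
    P.P1Optimal (k • w) x :=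
  ⟨h.1, fun x' hx' => by
    rw [smul_dotProduct, smul_dotProduct]
    exact smul_le_smul_of_nonneg_left (h.2 x' hx') hk⟩

lemma lowerImage_eq_empty (hp : p.Admissible P) (hc : -p.c ∈ A) : lowerImage P p.T A = ∅ := by
  refine eq_empty_of_forall_notMem ?_
  rintro _ ⟨t, ht, -⟩
  have hneg : 0 ≤ wOf p.T t ⬝ᵥ -p.c := ht (-p.c) hc
  rw [dotProduct_neg, hp.wOf_dotProduct_c] at hneg
  linarith

end DualObjective

/-! ### The dual algorithm -/

section MainLoop

variable {n m : ℕ} {P : CVOP n m} {p : Params m} {ε δ : ℝ}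
  {F : Set ((Fin n → ℝ) × (Fin (m + 1) → ℝ))} {s₀ : InitState n m}
  {D : Set (Fin (m + 1) → ℝ)} {s s' : DualState n m} {v : Fin (m + 1) → ℝ} {x : Fin n → ℝ}

/-- The invariant of the main loop after an initialization with output `s₀`: the outer
approximation `D` is cut off from `D₀` by points of `Xbar` only, and the points of `Xbar` and `Tbar`
come from weighted sum problems with nonzero weights in `(cone YOut)⁺`. -/
structure DualInvariant (P : CVOP n m) (p : Params m) (s₀ : InitState n m)
    (s : DualState n m) : Prop where
  isClosed_D : IsClosed s.D
  D_subset : s.D ⊆ initialD P p s₀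
  mem_D : ∀ t, wOf p.T t ∈ dualCone (cone s₀.YOut) →
    (∀ x ∈ s.Xbar, t (Fin.last m) ≤ wOf p.T t ⬝ᵥ P.Γ x) → t ∈ s.D
  finite_X : s.Xbar.Finite
  finite_T : s.Tbar.Finite
  subset_X : s₀.Xbar ⊆ s.Xbar
  X_optimal : ∀ x ∈ s.Xbar, ∃ w ∈ dualCone (cone s₀.YOut), w ≠ 0 ∧ P.P1Optimal w x
  T_optimal : ∀ t ∈ s.Tbar, wOf p.T t ∈ dualCone (cone s₀.YOut) ∧ ∃ x, P.P1Optimal (wOf p.T t) x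

lemma InitGuarantee.cone_subset_cone_YOut (h : InitGuarantee P p δ F s₀) :
    (P.C : Set (Fin (m + 1) → ℝ)) ⊆ cone s₀.YOut :=
  P.cone_subset_recessionCone_upperImage.trans h.isOuterApprox.1

lemma InitGuarantee.c_mem_interior (h : InitGuarantee P p δ F s₀) (hp : p.Admissible P) :
    p.c ∈ interior (cone s₀.YOut) :=
  interior_mono h.cone_subset_cone_YOut hp.c_mem

lemma mem_initialD_iff {t : Fin (m + 1) → ℝ} : t ∈ initialD P p s₀ ↔
    wOf p.T t ∈ dualCone (cone s₀.YOut) ∧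
      ∀ x ∈ s₀.Xbar, t (Fin.last m) ≤ wOf p.T t ⬝ᵥ P.Γ x := by
  simp [initialD]

lemma isClosed_initialD (P : CVOP n m) (p : Params m) (s₀ : InitState n m) :
    IsClosed (initialD P p s₀) :=
  ((isClosed_dualCone _).preimage (continuous_wOf p.T)).inter
    (isClosed_biInter fun _ _ => isClosed_le continuous_const
      ((continuous_wOf_dotProduct _ _).sub (continuous_apply _)))

/-- The weights `w(t)` of points of `D₀` lie in a compact section of `(cone YOut)⁺`, which bounds
all coordinates of `t` but the last one; the cut with `x` bounds the last one from above. -/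
lemma isKBounded_initialD (hp : p.Admissible P) (hc : p.c ∈ interior (cone s₀.YOut))
    (hx : x ∈ s₀.Xbar) : IsKBounded (initialD P p s₀) := by
  have hcont : Continuous fun w : Fin (m + 1) → ℝ =>
      Function.update (p.Tᵀ *ᵥ w) (Fin.last m) (w ⬝ᵥ P.Γ x) :=
    (continuous_const.matrix_mulVec continuous_id).update _
      (continuous_id.dotProduct continuous_const)
  refine ⟨_, ((isCompact_dualCone_section hc).image hcont).isBounded, fun t ht => ?_⟩
  obtain ⟨hw, hle⟩ := mem_initialD_iff.1 ht
  refine ⟨_, ⟨wOf p.T t, ⟨hw, hp.wOf_dotProduct_c t⟩, rfl⟩, _,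
    ⟨_, sub_nonneg.2 (hle x hx), rfl⟩, ?_⟩
  simp [sub_single_last, hp.transpose_mulVec_wOf]

lemma InitGuarantee.dualInvariant (h : InitGuarantee P p δ F s₀) (hp : p.Admissible P) :
    DualInvariant P p s₀
      { D := initialD P p s₀, M := ∅, Xbar := s₀.Xbar, Tbar := s₀.Tbar } where
  isClosed_D := isClosed_initialD P p s₀
  D_subset := Subset.rfl
  mem_D := fun _ hw hle => mem_initialD_iff.2 ⟨hw, hle⟩
  finite_X := h.Xbar_eq ▸ h.isSupportFamily.finite.image _
  finite_T := h.Tbar_eq ▸ h.isSupportFamily.finite.image _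
  subset_X := Subset.rfl
  X_optimal := by
    rw [h.Xbar_eq]
    rintro _ ⟨f, hf, rfl⟩
    exact ⟨f.2, h.mem_dualCone_YOut f hf, h.isSupportFamily.ne_zero f hf,
      h.isSupportFamily.optimal f hf⟩
  T_optimal := by
    rw [h.Tbar_eq]
    rintro _ ⟨f, hf, rfl⟩
    have hpos : 0 < f.2 ⬝ᵥ p.c := dotProduct_pos_of_mem_interior (h.mem_dualCone_YOut f hf)
      (h.isSupportFamily.ne_zero f hf) (h.c_mem_interior hp)
    rw [hp.wOf_dualPoint hpos.ne']
    exact ⟨smul_mem_dualCone (inv_nonneg.2 hpos.le) (h.mem_dualCone_YOut f hf), f.1,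
      (h.isSupportFamily.optimal f hf).smul (inv_nonneg.2 hpos.le)⟩

lemma DualInvariant.insert (h : DualInvariant P p s₀ s) (hp : p.Admissible P)
    (hv : wOf p.T v ∈ dualCone (cone s₀.YOut)) (hx : P.P1Optimal (wOf p.T v) x)
    (M : Set (Fin (m + 1) → ℝ)) :
    DualInvariant P p s₀ { s with
      Xbar := insert x s.Xbar
      Tbar := insert (p.Tᵀ *ᵥ wOf p.T v) s.Tbar
      M := M } where
  isClosed_D := h.isClosed_D
  D_subset := h.D_subset
  mem_D := fun t hw hle => h.mem_D t hw (forall_mem_insert.1 hle).2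
  finite_X := h.finite_X.insert _
  finite_T := h.finite_T.insert _
  subset_X := h.subset_X.trans (subset_insert _ _)
  X_optimal := forall_mem_insert.2 ⟨⟨_, hv, hp.wOf_ne_zero v, hx⟩, h.X_optimal⟩
  T_optimal := by
    refine forall_mem_insert.2 ⟨?_, h.T_optimal⟩
    rw [hp.wOf_transpose_mulVec (hp.wOf_dotProduct_c v)]
    exact ⟨hv, x, hx⟩

/-- The invariant of the vertex loop inside one round: the cuts collected in `M` are closed and
come from points of `Xbar`. -/
structure RoundInvariant (P : CVOP n m) (p : Params m) (s₀ : InitState n m)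
    (s : DualState n m) : Prop extends DualInvariant P p s₀ s where
  isClosed_M : IsClosed s.M
  mem_M : ∀ t, (∀ x ∈ s.Xbar, t (Fin.last m) ≤ wOf p.T t ⬝ᵥ P.Γ x) → t ∈ s.M

lemma RoundInvariant.of_processVertex (h : RoundInvariant P p s₀ s) (hp : p.Admissible P)
    (hv : wOf p.T v ∈ dualCone (cone s₀.YOut)) (hs : processVertex P p ε v s s') :
    RoundInvariant P p s₀ s' := by
  obtain ⟨x, hx, ⟨-, rfl⟩ | ⟨-, rfl⟩⟩ := hs
  · exact ⟨h.insert hp hv hx _, h.isClosed_M.inter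
      (isClosed_le (continuous_apply _) (continuous_wOf_dotProduct _ _)),
      fun t ht => ⟨h.mem_M t (forall_mem_insert.1 ht).2, (forall_mem_insert.1 ht).1⟩⟩
  · exact ⟨h.insert hp hv hx _, h.isClosed_M, fun t ht => h.mem_M t (forall_mem_insert.1 ht).2⟩

lemma DualInvariant.of_dualBody (h : DualInvariant P p s₀ s) (hp : p.Admissible P)
    (hs : dualBody P p ε s s') : DualInvariant P p s₀ s' := by
  obtain ⟨s₁, hfor, hcases⟩ := hs
  have hround : RoundInvariant P p s₀ s₁ := hfor.invariant
    (fun v hv _ _ ha => ha.of_processVertex hp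
      (mem_initialD_iff.1 (h.D_subset (extremePoints_subset hv))).1)
    ⟨{ h with }, isClosed_univ, fun _ _ => mem_univ _⟩
  rcases hcases with ⟨-, rfl⟩ | ⟨-, rfl⟩
  · exact { hround.toDualInvariant with
      isClosed_D := hround.isClosed_D.inter hround.isClosed_M
      D_subset := inter_subset_left.trans hround.D_subset
      mem_D := fun t hw hle => ⟨hround.mem_D t hw hle, hround.mem_M t hle⟩ }
  · exact hround.toDualInvariant

/-- The vertex `v` has been processed without being cut off. -/
def VertexDone (P : CVOP n m) (p : Params m) (ε : ℝ) (v : Fin (m + 1) → ℝ)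
    (s : DualState n m) : Prop :=
  ∃ x, P.P1Optimal (wOf p.T v) x ∧ v (Fin.last m) - wOf p.T v ⬝ᵥ P.Γ x ≤ ε ∧
    p.Tᵀ *ᵥ wOf p.T v ∈ s.Tbar

lemma vertexDone_of_forEach_processVertex (h : ForEach D (processVertex P p ε) s s')
    (hM : s'.M = univ) : ∀ v ∈ D, VertexDone P p ε v s' := by
  refine fun v hv => h.forall_mem (Q := fun v s => s.M = univ → VertexDone P p ε v s) ?_ ?_ v hv hM
  · rintro v s s' ⟨x, hx, ⟨-, rfl⟩ | ⟨hle, rfl⟩⟩ hM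
    · exact absurd (univ_subset_iff.1 (hM.ge.trans inter_subset_right))
        (setOf_last_le_ne_univ p.T (P.Γ x))
    · exact ⟨x, hx, hle, mem_insert _ _⟩
  · rintro v v' s s' hQ ⟨x, -, ⟨-, rfl⟩ | ⟨-, rfl⟩⟩ hM
    · exact absurd (univ_subset_iff.1 (hM.ge.trans inter_subset_right))
        (setOf_last_le_ne_univ p.T (P.Γ x))
    · exact (hQ hM).imp fun _ hy => hy.imp_right fun hy => hy.imp_right (mem_insert_of_mem _)

lemma vertexDone_of_dualBody (h : dualBody P p ε s s') (hM : s'.M = univ) :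
    (s'.D.extremePoints ℝ).Finite ∧ ∀ v ∈ s'.D.extremePoints ℝ, VertexDone P p ε v s' := by
  obtain ⟨s₁, hfor, ⟨hne, rfl⟩ | ⟨hM₁, rfl⟩⟩ := h
  · exact absurd hM hne
  · have hD : s'.D = s.D := hfor.invariant (I := fun a => a.D = s.D)
      (by rintro v - a a' ha ⟨x, -, ⟨-, rfl⟩ | ⟨-, rfl⟩⟩ <;> exact ha) rfl
    rw [hD]
    exact ⟨hfor.finite, vertexDone_of_forEach_processVertex hfor hM₁⟩

lemma DualInvariant.of_while (h : DualInvariant P p s₀ s) (hp : p.Admissible P) (hM : s.M ≠ univ)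
    (hwhile : While (fun a : DualState n m => a.M ≠ univ) (dualBody P p ε) s s') :
    DualInvariant P p s₀ s' ∧
      (s'.D.extremePoints ℝ).Finite ∧ ∀ v ∈ s'.D.extremePoints ℝ, VertexDone P p ε v s' := by
  obtain ⟨hinv, hdone⟩ := hwhile.invariant
    (I := fun a => DualInvariant P p s₀ a ∧ (a.M = univ → (a.D.extremePoints ℝ).Finite ∧
      ∀ v ∈ a.D.extremePoints ℝ, VertexDone P p ε v a))
    (fun _ _ ha hs => ⟨ha.1.of_dualBody hp hs, vertexDone_of_dualBody hs⟩)
    ⟨h, fun hMu => absurd hMu hM⟩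
  exact ⟨hinv, hdone (not_not.1 hwhile.2)⟩

end MainLoop

/-! ### Approximation of the lower and the upper image -/

section Approximation

variable {n m : ℕ} {P : CVOP n m} {p : Params m} {ε γ : ℝ} {s₀ : InitState n m}
  {s : DualState n m} {v w : Fin (m + 1) → ℝ}

lemma DualInvariant.D_subset_convexHull_sub_coneK (h : DualInvariant P p s₀ s)
    (hp : p.Admissible P) (hc : p.c ∈ interior (cone s₀.YOut)) (hX₀ : s₀.Xbar.Nonempty)
    (hfin : (s.D.extremePoints ℝ).Finite) :
    s.D ⊆ convexHull ℝ (s.D.extremePoints ℝ) - coneK m := by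
  obtain ⟨x, hx⟩ := hX₀
  obtain ⟨S, hS, hDS⟩ := isKBounded_initialD hp hc hx
  exact IsKBounded.subset_convexHull_extremePoints_sub_coneK ⟨S, hS, h.D_subset.trans hDS⟩
    h.isClosed_D hfin

lemma last_sub_le_of_vertexDone {V D : Set (Fin (m + 1) → ℝ)} (hD : D ⊆ convexHull ℝ V - coneK m)
    (hdone : ∀ v ∈ V, VertexDone P p ε v s) :
    ∀ t ∈ D, ∀ x ∈ P.X, t (Fin.last m) - ε ≤ wOf p.T t ⬝ᵥ P.Γ x := by
  intro t ht x hx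
  obtain ⟨u, hu, _, ⟨k, hk, rfl⟩, rfl⟩ := hD ht
  have hle : u (Fin.last m) - ε ≤ wOf p.T u ⬝ᵥ P.Γ x :=
    convexHull_min (fun v hv => by
      obtain ⟨y, hy, hle, -⟩ := hdone v hv
      rw [mem_ofPred_eq]
      linarith [hy.2 x hx]) (convex_setOf_last_sub_le p.T (P.Γ x) ε) hu
  simp only [sub_single_last, wOf_update_last, Function.update_self]
  linarith

lemma VertexDone.mem_convexHull_sub_coneK_add (h : VertexDone P p ε v s) (hp : p.Admissible P) :
    v ∈ convexHull ℝ (toExt ⁻¹' (dualObjective P p.T '' s.Tbar)) - coneK m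
      + {Pi.single (Fin.last m) ε} := by
  obtain ⟨x, hx, hle, hT⟩ := h
  rw [hp.transpose_mulVec_wOf] at hT
  refine ⟨_, ⟨Function.update v (Fin.last m) (wOf p.T v ⬝ᵥ P.Γ x), subset_convexHull ℝ _
    ⟨_, hT, by rw [dualObjective_update_last, hx.dualObjective_eq]⟩, _, ⟨_, sub_nonneg.2 hle, rfl⟩,
    rfl⟩, _, rfl, ?_⟩
  simp only [← eq_sub_iff_add_eq, sub_single_last, Function.update_idem, Function.update_self]
  congr 1
  ring

lemma subset_convexHull_sub_coneK_add_of_vertexDone {V D : Set (Fin (m + 1) → ℝ)}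
    (hD : D ⊆ convexHull ℝ V - coneK m) (hdone : ∀ v ∈ V, VertexDone P p ε v s)
    (hp : p.Admissible P) :
    D ⊆ convexHull ℝ (toExt ⁻¹' (dualObjective P p.T '' s.Tbar)) - coneK m
      + {Pi.single (Fin.last m) ε} := by
  intro t ht
  obtain ⟨u, hu, _, ⟨k, hk, rfl⟩, rfl⟩ := hD ht
  obtain ⟨_, ⟨a, ha, _, ⟨l, hl, rfl⟩, rfl⟩, _, rfl, rfl⟩ := convexHull_min
    (fun v hv => (hdone v hv).mem_convexHull_sub_coneK_add hp)
    (((convex_convexHull ℝ _).sub (convex_coneK m)).add (convex_singleton _)) hu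
  refine ⟨_, ⟨a, ha, _, ⟨l + k, add_nonneg hl hk, rfl⟩, rfl⟩, _, rfl, ?_⟩
  simp only [Pi.single_add]
  abel

lemma DualInvariant.lowerImage_subset (h : DualInvariant P p s₀ s) (hp : p.Admissible P)
    (hX : P.X.Nonempty) (hD : s.D ⊆ convexHull ℝ (s.D.extremePoints ℝ) - coneK m)
    (hdone : ∀ v ∈ s.D.extremePoints ℝ, VertexDone P p ε v s) :
    lowerImage P p.T (cone s₀.YOut) ⊆
      toExt '' (convexHull ℝ (toExt ⁻¹' (dualObjective P p.T '' s.Tbar)) - coneK m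
        + {Pi.single (Fin.last m) ε}) := by
  rintro _ ⟨t, ht, k, hk, rfl⟩
  have hmem_D : ∀ r : ℝ, (∀ x ∈ s.Xbar, r ≤ wOf p.T t ⬝ᵥ P.Γ x) →
      Function.update t (Fin.last m) r ∈ s.D := fun r hr =>
    h.mem_D _ (by rwa [wOf_update_last]) (by simpa only [wOf_update_last, Function.update_self])
  obtain ⟨γ, hγ⟩ := (h.finite_X.image fun x => wOf p.T t ⬝ᵥ P.Γ x).bddBelow
  have hbound : ∀ x ∈ P.X, γ - ε ≤ wOf p.T t ⬝ᵥ P.Γ x := by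
    simpa only [wOf_update_last, Function.update_self] using
      last_sub_le_of_vertexDone hD hdone _ (hmem_D γ fun x hx => hγ (mem_image_of_mem _ hx))
  obtain ⟨r, hr, hrX⟩ := exists_dualObjective_eq_toExt hX hbound
  rw [hr, shift_toExt_update_last]
  refine mem_image_of_mem _ (subset_convexHull_sub_coneK_add_of_vertexDone hD hdone hp
    (hmem_D _ fun x hx => ?_))
  obtain ⟨_, -, -, hopt⟩ := h.X_optimal x hx
  linarith [hrX x hopt.1]

lemma DualInvariant.sub_le_dotProduct (h : DualInvariant P p s₀ s) (hp : p.Admissible P)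
    (hlast : ∀ t ∈ s.D, ∀ x ∈ P.X, t (Fin.last m) - ε ≤ wOf p.T t ⬝ᵥ P.Γ x)
    (hw : w ∈ dualCone (cone s₀.YOut)) (hwc : 0 < w ⬝ᵥ p.c) (hγ : ∀ x ∈ s.Xbar, γ ≤ w ⬝ᵥ P.Γ x) :
    ∀ x ∈ P.X, γ - ε * (w ⬝ᵥ p.c) ≤ w ⬝ᵥ P.Γ x := by
  intro x hx
  have hinv : 0 ≤ (w ⬝ᵥ p.c)⁻¹ := inv_nonneg.2 hwc.le
  set t := Function.update (dualPoint p w) (Fin.last m) ((w ⬝ᵥ p.c)⁻¹ * γ) with ht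
  have hwt : wOf p.T t = (w ⬝ᵥ p.c)⁻¹ • w := by rw [wOf_update_last, hp.wOf_dualPoint hwc.ne']
  have htD : t ∈ s.D := by
    refine h.mem_D t (hwt ▸ smul_mem_dualCone hinv hw) fun y hy => ?_
    rw [hwt, ht, Function.update_self, smul_dotProduct]
    exact mul_le_mul_of_nonneg_left (hγ y hy) hinv
  have hle := hlast t htD x hx
  rw [hwt, ht, Function.update_self, smul_dotProduct, smul_eq_mul] at hle
  refine le_of_mul_le_mul_left ?_ (inv_pos.2 hwc)
  rwa [mul_sub, mul_left_comm, inv_mul_cancel₀ hwc.ne', mul_one]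

lemma DualInvariant.upperImage_subset (h : DualInvariant P p s₀ s) (hp : p.Admissible P)
    (hc : p.c ∈ interior (cone s₀.YOut)) (hX₀ : s₀.Xbar.Nonempty)
    (hC : (P.C : Set (Fin (m + 1) → ℝ)) ⊆ cone s₀.YOut) (hclosed : IsClosed (cone s₀.YOut))
    (hlast : ∀ t ∈ s.D, ∀ x ∈ P.X, t (Fin.last m) - ε ≤ wOf p.T t ⬝ᵥ P.Γ x) :
    P.upperImage ⊆ convexHull ℝ (P.Γ '' s.Xbar) + cone s₀.YOut - {ε • p.c} := by
  intro y hy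
  by_contra hnot
  have hconv : Convex ℝ (convexHull ℝ (P.Γ '' s.Xbar) + cone s₀.YOut - {ε • p.c}) :=
    ((convex_convexHull ℝ _).add (convex_cone _)).sub (convex_singleton _)
  have hcl : IsClosed (convexHull ℝ (P.Γ '' s.Xbar) + cone s₀.YOut - {ε • p.c}) := by
    rw [sub_eq_add_neg, neg_singleton]
    exact (hclosed.add_left_of_isCompact
      ((h.finite_X.image _).isCompact_convexHull ℝ)).add_right_of_isCompact isCompact_singleton
  obtain ⟨w, γ, hwy, hw⟩ := exists_dotProduct_lt_of_notMem hconv hcl hnot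
  have hlt : ∀ x ∈ s.Xbar, ∀ a ∈ cone s₀.YOut,
      γ < w ⬝ᵥ P.Γ x - ε * (w ⬝ᵥ p.c) + w ⬝ᵥ a := fun x hx a ha => by
    have hxa := hw (P.Γ x + a - ε • p.c) (sub_mem_sub
      (add_mem_add (subset_convexHull ℝ _ (mem_image_of_mem _ hx)) ha) (mem_singleton _))
    rw [dotProduct_sub, dotProduct_add, dotProduct_smul, smul_eq_mul] at hxa
    linarith
  have hltX : ∀ x ∈ s.Xbar, γ + ε * (w ⬝ᵥ p.c) < w ⬝ᵥ P.Γ x := fun x hx => by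
    have hx0 := hlt x hx 0 (zero_mem_cone _)
    rw [dotProduct_zero] at hx0
    linarith
  obtain ⟨x₁, hx₁⟩ := hX₀.mono h.subset_X
  have hwY : w ∈ dualCone (cone s₀.YOut) := fun a ha =>
    nonneg_of_forall_lt_add_mul fun k hk => by
      simpa only [dotProduct_smul, smul_eq_mul] using hlt x₁ hx₁ _ (smul_mem_cone hk ha)
  have hw0 : w ≠ 0 := by
    rintro rfl
    have hγ := hltX x₁ hx₁
    simp only [zero_dotProduct, mul_zero, add_zero] at hγ hwy
    exact hγ.not_gt hwy
  have hX := h.sub_le_dotProduct hp hlast hwY (dotProduct_pos_of_mem_interior hwY hw0 hc)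
    fun x hx => (hltX x hx).le
  simp only [add_sub_cancel_right] at hX
  exact hwy.not_ge (CVOP.le_dotProduct_of_mem_upperImage (dualCone_anti hC hwY) hX y hy)

lemma DualInvariant.isDualMaximizer (h : DualInvariant P p s₀ s) :
    ∀ t ∈ s.Tbar, IsDualMaximizer P p.T (cone s₀.YOut) t :=
  fun t ht => let ⟨hw, _, hx⟩ := h.T_optimal t ht
    hx.isDualMaximizer hw

lemma DualInvariant.isWeakMinimizer (h : DualInvariant P p s₀ s)
    (hC : (P.C : Set (Fin (m + 1) → ℝ)) ⊆ cone s₀.YOut) : ∀ x ∈ s.Xbar, P.IsWeakMinimizer x :=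
  fun x hx => let ⟨_, hw, h0, hopt⟩ := h.X_optimal x hx
    hopt.isWeakMinimizer (dualCone_anti hC hw) h0

end Approximation

end UnboundedCVOP

open UnboundedCVOP in
theorem mainTheorem4_general {n m : ℕ} (P : CVOP n m)
    (hconv : Convex ℝ (P.Γ '' P.X + (P.C : Set (Fin (m + 1) → ℝ))))
    (hC : IsClosed (P.C : Set (Fin (m + 1) → ℝ)))
    (p : Params m) (hp : p.Admissible P) (ε δ : ℝ) (hδ : 0 ≤ δ)
    (Xbar : Set (Fin n → ℝ)) (YOut Tbar : Set (Fin (m + 1) → ℝ))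
    (hrun : DualAlgorithmOutputs P p ε δ Xbar YOut Tbar) :
    (P.upperImage ≠ univ → P.IsFiniteWeakSolution p.c ε δ Xbar YOut) ∧
      IsFiniteDualSolution P p.T ε δ Tbar YOut := by
  obtain ⟨s₀, hinit, -, s, hwhile, rfl, rfl, rfl⟩ := hrun
  have hX : P.X.Nonempty := hinit.imp fun _ h => h.1
  obtain ⟨F, hF⟩ := hinit.exists_guarantee hp hconv hC hδ
  obtain ⟨hinv, hfin, hdone⟩ := (hF.dualInvariant hp).of_while hp empty_ne_univ hwhile
  rcases F.eq_empty_or_nonempty with rfl | hne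
  · have hrec := hF.recessionCone_eq_univ rfl
    have huniv := eq_univ_of_recessionCone_eq_univ
      ((hX.image P.Γ).mono P.image_subset_upperImage) hrec
    have hlow := lowerImage_eq_empty hp (hF.isOuterApprox.1 (hrec ▸ mem_univ (-p.c)))
    exact ⟨fun hproper => absurd huniv hproper, hF.finite_YOut, hF.isOuterApprox,
      hinv.finite_T, hinv.isDualMaximizer, hlow ▸ empty_subset _⟩
  · have hc := hF.c_mem_interior hp
    have hX₀ : s₀.Xbar.Nonempty := hF.Xbar_eq ▸ hne.image _
    have hD := hinv.D_subset_convexHull_sub_coneK hp hc hX₀ hfin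
    have hup := hinv.upperImage_subset hp hc hX₀ hF.cone_subset_cone_YOut hF.isClosed_cone
      (last_sub_le_of_vertexDone hD hdone)
    have hlow := hinv.lowerImage_subset hp hX hD hdone
    exact ⟨fun _ => ⟨hinv.finite_X, hF.finite_YOut, hX₀.mono hinv.subset_X,
      hinv.isWeakMinimizer hF.cone_subset_cone_YOut, hF.isOuterApprox, hup⟩,
      hF.finite_YOut, hF.isOuterApprox, hinv.finite_T, hinv.isDualMaximizer, hlow⟩

open UnboundedCVOP in
theorem mainTheorem4 {n m : ℕ} (P : CVOP n m) (hP : P.Assumption)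
    (p : Params m) (hp : p.Admissible P) (ε δ : ℝ) (hε : 0 < ε) (hδ : 0 < δ)
    (Xbar : Set (Fin n → ℝ)) (YOut Tbar : Set (Fin (m + 1) → ℝ))
    (hrun : DualAlgorithmOutputs P p ε δ Xbar YOut Tbar) :
    (P.upperImage ≠ Set.univ → P.IsFiniteWeakSolution p.c ε δ Xbar YOut) ∧
      IsFiniteDualSolution P p.T ε δ Tbar YOut :=
  mainTheorem4_general P hP.convex_image_add_cone hP.C_closed p hp ε δ hδ.le Xbar YOut Tbar hrun
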